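/- For $\tau\in\mathbb H=\{\operatorname{Im}\tau>0\}$ let $\wp(z|\tau)$ and $\zeta(z|\tau)$ be the Weierstrass functions of the lattice $\mathbb Z+\mathbb Z\tau$, where $\zeta$ is the odd primitive of $-\wp$; let $\eta_1(\tau)=\zeta(z+1|\tau)-\zeta(z|\tau)$ and $\eta_2(\tau)=\zeta(z+\tau|\tau)-\zeta(z|\tau)$ be the quasi-periods, let $e_1,e_2,e_3$ be the values of $\wp(\cdot|\tau)$ at $\frac12,\frac\tau2,\frac{1+\tau}2$, and let $t=t(\tau)=\frac{e_3-e_1}{e_2-e_1}\in\mathbb C\setminus\{0,1\}$. For a pair $(r,s)\in\mathbb C^2\setminus\frac12\mathbb Z^2$, let $$\lambda^{(0)}_{r,s}(t)=\frac{1}{e_2-e_1}\left(\wp(a|\tau)+\frac{\wp'(a|\tau)}{2\,(\zeta(a|\tau)-r\eta_1-s\eta_2)}-e_1\right),\qquad a=r+s\tau,$$ be Hitchin's solution of the Painlevé VI equation with parameters $(\frac18,-\frac18,\frac18,\frac38)$. Let $\mu^{(0)}_{r,s}(t)$ be the corresponding function for which $(\lambda^{(0)}_{r,s},\mu^{(0)}_{r,s})$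 solves the Hamiltonian system $\frac{d\lambda}{dt}=\frac{\partial K}{\partial\mu}$, $\frac{d\mu}{dt}=-\frac{\partial K}{\partial\lambda}$ with $$K=\tfrac{1}{t(t-1)}\Big\{\lambda(\lambda-1)(\lambda-t)\mu^2+\theta_0(\theta_0+\theta_4)(\lambda-t)-\big[\theta_1(\lambda-1)(\lambda-t)+\theta_2\lambda(\lambda-t)+(\theta_3-1)\lambda(\lambda-1)\big]\mu\Big\}$$ and parameter $\theta^0=(-\frac12,\frac12,\frac12,\frac12,\frac12)$. The Okamoto transformations of $(\theta,\lambda,\mu)$ (with $t$ fixed) are as follows. * $\kappa_0$ sends $\theta$ to $(-\theta_0,\theta_1+\theta_0,\theta_2+\theta_0,\theta_3+\theta_0,\theta_4+\theta_0)$, $\lambda$ to $\lambda+\theta_0/\mu$, and fixes $\mu$. * For $i=1,2,3$, $\kappa_i$ replaces $\theta_0$ by $\theta_0+\theta_i$ and $\theta_i$ by $-\theta_i$, fixes $\lambda$, and sends $\mu$ to $\mu-\frac{\theta_1}{\lambda}$, $\mu-\frac{\theta_2}{\lambda-1}$, $\mu-\frac{\theta_3}{\lambda-t}$ respectively. * $\kappa_4$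 replaces $\theta_0$ by $\theta_0+\theta_4$ and $\theta_4$ by $-\theta_4$, and fixes $\lambda$ and $\mu$. Put $\kappa^{0,1}=\kappa_0\kappa_3\kappa_2\kappa_1$ and $\kappa_5=\kappa_0(\kappa_3\kappa_2\kappa_1\kappa_0)^2\kappa_4$, where the rightmost transformation is applied first. Let $(\lambda^{(n)}_{r,s},\mu^{(n)}_{r,s})$ be the image of $(\lambda^{(0)}_{r,s},\mu^{(0)}_{r,s})$ (with parameter $\theta^0$) under $\kappa_5^m$ if $n=2m$, and under $\kappa_5^m\kappa^{0,1}$ if $n=2m+1$. **Theorem.** For $(r,s)=(\frac14,0)$ the function $\mu^{(0)}_{\frac14,0}$ exists and is unique, as a holomorphic function of $\tau\in\mathbb H$. Let $t^{1/2}$ be the holomorphic square root of $t(\tau)$ on $\mathbb H$ that tends to $1$ as $\operatorname{Im}\tau\to+\infty$. Then for every $n\ge 0$, on all of $\mathbb H$, $$\lambda^{(n)}_{\frac14,0}(t)=\frac{(-1)^n}{2n+1}\,t^{1/2},\qquad \mu^{(n)}_{\frac14,0}(t)=\frac{1}{4\lambda^{(n)}_{\frac14,0}(t)}=(-1)^n\,\frac{2n+1}{4}\,t^{-1/2}.$$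 In particular, $t=1$ is not a branch point of the multivalued function $\lambda^{(n)}_{\frac14,0}(t)$ of $t\in\mathbb C\setminus\{0,1\}$: there is a neighbourhood $U$ of $1$ such that continuation of $\lambda^{(n)}_{\frac14,0}$ along any loop in $U\setminus\{0,1\}$, starting from any of its branches, does not change its value. -/

import Mathlib

open UpperHalfPlane Filter Topology
open scoped Manifold

noncomputable section

namespace PVI

/-! ### Elliptic functions of the lattice `ℤ + ℤ τ` -/

/-- The pair of periods `ω₁ = 1`, `ω₂ = τ`. -/
def periods (τ : ℍ) : PeriodPair where
  ω₁ := 1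
  ω₂ := τ
  indep := by
    rw [LinearIndependent.pair_iff]
    intro s t h
    have him := congrArg Complex.im h
    have hre := congrArg Complex.re h
    simp at him hre
    have ht : t = 0 := him.resolve_right τ.im_ne_zero
    subst ht
    simpa using hre

/-- `℘(z | τ)`. -/
def wp (τ : ℍ) (z : ℂ) : ℂ := (periods τ).weierstrassP z

/-- `℘'(z | τ)`, the derivative with respect to `z`. -/
def wpDeriv (τ : ℍ) (z : ℂ) : ℂ := deriv (wp τ) z

/-- The Weierstrass zeta function
`ζ(z | τ) = 1 / z + ∑_{ω ≠ 0} (1 / (z - ω) + 1 / ω + z / ω ^ 2)`, the odd primitive of `-℘`.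
The term of the sum below at `ω = 0` is `1 / z`, because division by zero gives zero. -/
def wzeta (τ : ℍ) (z : ℂ) : ℂ :=
  ∑' ω : (periods τ).lattice, (1 / (z - ω) + 1 / (ω : ℂ) + z / (ω : ℂ) ^ 2)

/-- The quasi-period `η₁ = ζ(z + 1) - ζ(z)`, evaluated at `z = -1/2`. -/
def eta1 (τ : ℍ) : ℂ := wzeta τ (1 / 2) - wzeta τ (-(1 / 2))

/-- The quasi-period `η₂ = ζ(z + τ) - ζ(z)`, evaluated at `z = -τ/2`. -/
def eta2 (τ : ℍ) : ℂ := wzeta τ ((τ : ℂ) / 2) - wzeta τ (-((τ : ℂ) / 2))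

def e1 (τ : ℍ) : ℂ := wp τ (1 / 2)
def e2 (τ : ℍ) : ℂ := wp τ ((τ : ℂ) / 2)
def e3 (τ : ℍ) : ℂ := wp τ ((1 + (τ : ℂ)) / 2)

/-- The covering `t : ℍ → ℂ ∖ {0, 1}`, `t = (e₃ - e₁) / (e₂ - e₁)`. -/
def tOf (τ : ℍ) : ℂ := (e3 τ - e1 τ) / (e2 τ - e1 τ)

/-- `Z_{r,s}(τ) = ζ(r + s τ | τ) - r η₁(τ) - s η₂(τ)`. -/
def hitchinZ (r s : ℂ) (τ : ℍ) : ℂ :=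
  wzeta τ (r + s * τ) - r * eta1 τ - s * eta2 τ

/-- Hitchin's solution `λ⁽⁰⁾_{r,s}`, as a function of `τ`, where `t = tOf τ`:
`λ⁽⁰⁾_{r,s}(t) = (℘(a) + ℘'(a) / (2 Z_{r,s}) - e₁) / (e₂ - e₁)` with `a = r + s τ`. -/
def hitchinLam (r s : ℂ) (τ : ℍ) : ℂ :=
  (wp τ (r + s * τ) + wpDeriv τ (r + s * τ) / (2 * hitchinZ r s τ) - e1 τ) / (e2 τ - e1 τ)

/-! ### The Hamiltonian system of Painlevé VI -/

/-- Parameters `(θ₀, θ₁, θ₂, θ₃, θ₄)`; the relevant ones satisfy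
`2 θ₀ + θ₁ + θ₂ + θ₃ + θ₄ = 1`. -/
structure Param where
  th0 : ℂ
  th1 : ℂ
  th2 : ℂ
  th3 : ℂ
  th4 : ℂ

/-- The parameter `θ⁰ = (-1/2, 1/2, 1/2, 1/2, 1/2)` of
`PVI(1/8, -1/8, 1/8, 3/8)`. -/
def thetaZero : Param := ⟨-(1 / 2), 1 / 2, 1 / 2, 1 / 2, 1 / 2⟩

/-- The Hamiltonian `K(λ, μ, t)`. -/
def hamiltonian (θ : Param) (l m t : ℂ) : ℂ :=
  1 / (t * (t - 1)) *
    (l * (l - 1) * (l - t) * m ^ 2 + θ.th0 * (θ.th0 + θ.th4) * (l - t)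
      - (θ.th1 * (l - 1) * (l - t) + θ.th2 * l * (l - t) + (θ.th3 - 1) * l * (l - 1)) * m)

/-- The derivative `df/dτ` of a function on the upper half plane. -/
def tauDeriv (f : ℍ → ℂ) (τ : ℍ) : ℂ := deriv (f ∘ ofComplex) (τ : ℂ)

/-- `(λ, μ)`, given as a pair of holomorphic functions of `τ ∈ ℍ` through `t = tOf τ`, is a
solution of the Hamiltonian system `dλ/dt = ∂K/∂μ`, `dμ/dt = -∂K/∂λ`. By the chain rule
`df/dτ = (df/dt) (dt/dτ)`. -/
structure IsHamiltonianSolution (θ : Param) (lam mu : ℍ → ℂ) : Prop where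
  holo_lam : MDifferentiable 𝓘(ℂ) 𝓘(ℂ) lam
  holo_mu : MDifferentiable 𝓘(ℂ) 𝓘(ℂ) mu
  eq_lam : ∀ τ : ℍ, tauDeriv lam τ =
    deriv (fun m => hamiltonian θ (lam τ) m (tOf τ)) (mu τ) * tauDeriv tOf τ
  eq_mu : ∀ τ : ℍ, tauDeriv mu τ =
    -deriv (fun l => hamiltonian θ l (mu τ) (tOf τ)) (lam τ) * tauDeriv tOf τ

/-! ### Okamoto transformations -/

/-- A parameter together with the values of `λ`, `μ` and `t`. -/
structure State where
  θ : Param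
  lam : ℂ
  mu : ℂ
  t : ℂ

def kappa0 (x : State) : State where
  θ := ⟨-x.θ.th0, x.θ.th1 + x.θ.th0, x.θ.th2 + x.θ.th0, x.θ.th3 + x.θ.th0, x.θ.th4 + x.θ.th0⟩
  lam := x.lam + x.θ.th0 / x.mu
  mu := x.mu
  t := x.t

def kappa1 (x : State) : State where
  θ := ⟨x.θ.th0 + x.θ.th1, -x.θ.th1, x.θ.th2, x.θ.th3, x.θ.th4⟩
  lam := x.lam
  mu := x.mu - x.θ.th1 / x.lam
  t := x.t

def kappa2 (x : State) : State where
  θ := ⟨x.θ.th0 + x.θ.th2, x.θ.th1, -x.θ.th2, x.θ.th3, x.θ.th4⟩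
  lam := x.lam
  mu := x.mu - x.θ.th2 / (x.lam - 1)
  t := x.t

def kappa3 (x : State) : State where
  θ := ⟨x.θ.th0 + x.θ.th3, x.θ.th1, x.θ.th2, -x.θ.th3, x.θ.th4⟩
  lam := x.lam
  mu := x.mu - x.θ.th3 / (x.lam - x.t)
  t := x.t

def kappa4 (x : State) : State where
  θ := ⟨x.θ.th0 + x.θ.th4, x.θ.th1, x.θ.th2, x.θ.th3, -x.θ.th4⟩
  lam := x.lam
  mu := x.mu
  t := x.t

/-- `κ^{0,1} = κ₀ κ₃ κ₂ κ₁`. -/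
def kappa01 : State → State := kappa0 ∘ kappa3 ∘ kappa2 ∘ kappa1

/-- `κ₅ = κ₀ (κ₃ κ₂ κ₁ κ₀)² κ₄`. -/
def kappa5 : State → State :=
  kappa0 ∘ (kappa3 ∘ kappa2 ∘ kappa1 ∘ kappa0)^[2] ∘ kappa4

/-- `κ^{0,n}`, equal to `κ₅ᵐ` for `n = 2 m` and to `κ₅ᵐ κ^{0,1}` for `n = 2 m + 1`. -/
def kappa0n (n : ℕ) : State → State :=
  if Even n then kappa5^[n / 2] else kappa5^[n / 2] ∘ kappa01

/-- `λ⁽ⁿ⁾`, obtained by `κ^{0,n}` from a solution `(λ⁽⁰⁾, μ⁽⁰⁾)` with parameter `θ⁰`. -/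
def lamN (n : ℕ) (lam0 mu0 : ℍ → ℂ) (τ : ℍ) : ℂ :=
  (kappa0n n ⟨thetaZero, lam0 τ, mu0 τ, tOf τ⟩).lam

/-- `μ⁽ⁿ⁾`, obtained by `κ^{0,n}` from a solution `(λ⁽⁰⁾, μ⁽⁰⁾)` with parameter `θ⁰`. -/
def muN (n : ℕ) (lam0 mu0 : ℍ → ℂ) (τ : ℍ) : ℂ :=
  (kappa0n n ⟨thetaZero, lam0 τ, mu0 τ, tOf τ⟩).mu

/-! ### Branch points -/

/-- A function `f` on `ℍ` is a multivalued function of `t = tOf τ ∈ ℂ ∖ {0, 1}`. A path in `ℍ`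
whose end points have the same image is a loop in the `t`-plane, and `f` at the end points gives
the values before and after continuation along this loop. The point `t₀` is a branch point if
arbitrarily close to `t₀` there are loops in the punctured neighbourhood along which the
continuation changes the value. -/
def IsBranchPoint (f : ℍ → ℂ) (t₀ : ℂ) : Prop :=
  ∀ U ∈ 𝓝 t₀, ∃ τ₁ τ₂ : ℍ,
    JoinedIn (tOf ⁻¹' (U \ {t₀})) τ₁ τ₂ ∧ tOf τ₁ = tOf τ₂ ∧ f τ₁ ≠ f τ₂

end PVI

end

/-! The point is that at `a = 1/4` Hitchin's solution is itself a square root of `t`. The addition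
formula `zetaDiff_mul` with `a = 1/4` and `z = 1/2`, together with `ζ(3/4) = η₁ - ζ(1/4)`, gives `4
Z (℘(1/4) - e₁) = -℘'(1/4)` (`hitchinZ_quarter`), so Hitchin's quotient collapses to `(℘(1/4) - e₁)
/ (e₁ - e₂)`. The product `(℘(z) - e₁) (℘(z + 1/2) - e₁)` is constant; comparing `z = 1/4` with `z =
τ/2` gives `(℘(1/4) - e₁)² = (e₁ - e₂) (e₁ - e₃)` (`wp_quarter_sub_sq`), hence `λ² = t`. Both
identities come from Liouville's theorem for elliptic functions.

Holomorphy in `τ` and the choice of branch come from summing `℘` over the rows of the lattice: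
differences of values of `℘` become series in `π² / sin²`, which converge locally uniformly and have
explicit limits at `i∞`.

Along `λ² = t`, the defect in the first Hamiltonian equation is a nowhere vanishing multiple of `(μ
- 1 / (4 λ)) λ'`. This gives existence at once, and uniqueness because holomorphic functions on a
connected set have no zero divisors and `λ` is not constant.

The Okamoto transformations then act by algebra on the one-parameter family `sqrtState`: `κ^{0,1}`
takes index 0 to index 1 and flips the sign of the root, `κ₅` raises the index by 2 and keeps the
sign. So `λ⁽ⁿ⁾` is a constant multiple of `t^{1/2}`, which has no monodromy near `t = 1`. -/

noncomputable section

namespace PVI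

section

/-! ### Elliptic functions without poles -/

/-- A meromorphic function with removable singularities that is periodic with respect to a lattice
is constant, up to its values at the points where it is not continuous. -/
lemma exists_eq_const_of_periodic (L : PeriodPair) (f : ℂ → ℂ) (hf : ∀ z, MeromorphicAt f z)
    (hord : ∀ z, 0 ≤ meromorphicOrderAt f z)
    (hper : ∀ z, ∀ l ∈ L.lattice, ∀ᶠ w in 𝓝[≠] z, f (w + l) = f w) :
    ∃ c, (∀ z, Tendsto f (𝓝[≠] z) (𝓝 c)) ∧ ∀ z, ContinuousAt f z → f z = c := by
  choose g hg hfg using fun z => (hf z).meromorphicOrderAt_nonneg_iff.mp (hord z)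
  have hlim : ∀ z, Tendsto f (𝓝[≠] z) (𝓝 (g z z)) := fun z =>
    ((hg z).continuousAt.tendsto.mono_left nhdsWithin_le_nhds).congr' (hfg z).symm
  -- `F` fills in the removable singularities: its value at each point is the limit of `f` there.
  -- Near `z` it agrees with the local extension `g z`, so it is entire; periodicity makes it
  -- bounded and Liouville applies.
  let F : ℂ → ℂ := fun z => g z z
  have hF : ∀ z, F =ᶠ[𝓝 z] g z := by
    intro z
    have h1 : ∀ᶠ w in 𝓝[≠] z, f =ᶠ[𝓝 w] g z := by
      have := eventually_nhdsWithin_iff.mp (hfg z)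
      rw [eventually_nhdsWithin_iff]
      filter_upwards [eventually_eventually_nhds.mpr this] with w hw hne
      filter_upwards [hw, isOpen_compl_singleton.mem_nhds hne] with v hv hv' using hv hv'
    have h2 : ∀ᶠ w in 𝓝 z, AnalyticAt ℂ (g z) w := (hg z).eventually_analyticAt
    rw [eventually_nhdsWithin_iff] at h1
    filter_upwards [h1, h2] with w hw1 hw2
    by_cases hwz : w = z
    · rw [hwz]
    · refine tendsto_nhds_unique (hlim w) ?_
      exact (hw2.continuousAt.tendsto.mono_left nhdsWithin_le_nhds).congr'
        ((hw1 hwz).symm.filter_mono nhdsWithin_le_nhds)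
  have hFd : Differentiable ℂ F := fun z =>
    (hg z).differentiableAt.congr_of_eventuallyEq (hF z)
  have hFper : ∀ z, ∀ l ∈ L.lattice, F (z + l) = F z := by
    intro z l hl
    refine tendsto_nhds_unique ?_ (hlim z)
    have h := hlim (z + l)
    have ht : Tendsto (fun w => w + l) (𝓝[≠] z) (𝓝[≠] (z + l)) := by
      refine tendsto_nhdsWithin_iff.mpr ⟨?_, ?_⟩
      · exact (continuous_add_const l).tendsto z |>.mono_left nhdsWithin_le_nhds
      · filter_upwards [self_mem_nhdsWithin] with w hw
        simpa using hw
    exact (h.comp ht).congr' (hper z l hl)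
  have hconst : ∀ z, F z = F 0 := fun z =>
    hFd.apply_eq_apply_of_bounded (IsZLattice.isCompact_range_of_periodic L.lattice _
      hFd.continuous fun z w hw ↦ hFper z w hw).isBounded z 0
  have hlim' : ∀ z, Tendsto f (𝓝[≠] z) (𝓝 (F 0)) := fun z => hconst z ▸ hlim z
  exact ⟨F 0, hlim', fun z hz =>
    tendsto_nhds_unique (hz.tendsto.mono_left nhdsWithin_le_nhds) (hlim' z)⟩

lemma natCast_le_meromorphicOrderAt {g : ℂ → ℂ} {z : ℂ} (hg : AnalyticAt ℂ g z) (n : ℕ)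
    (h : ∀ i < n, iteratedDeriv i g z = 0) : (n : WithTop ℤ) ≤ meromorphicOrderAt g z := by
  rw [hg.meromorphicOrderAt_eq]
  have := (natCast_le_analyticOrderAt_iff_iteratedDeriv_eq_zero hg).mpr h
  cases h : analyticOrderAt g z with
  | top => simp
  | coe m =>
    rw [h] at this
    have hn : n ≤ m := by exact_mod_cast this
    simp only [ENat.map_natCast]
    exact WithTop.coe_le_coe.mpr (Int.ofNat_le.mpr hn)

lemma two_le_meromorphicOrderAt {g : ℂ → ℂ} {z : ℂ} (hg : AnalyticAt ℂ g z) (h0 : g z = 0)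
    (h1 : deriv g z = 0) : 2 ≤ meromorphicOrderAt g z := by
  refine natCast_le_meromorphicOrderAt hg 2 fun i hi => ?_
  interval_cases i
  · simpa using h0
  · simpa using h1

lemma one_le_meromorphicOrderAt {g : ℂ → ℂ} {z : ℂ} (hg : AnalyticAt ℂ g z) (h0 : g z = 0) :
    1 ≤ meromorphicOrderAt g z := by
  have := natCast_le_meromorphicOrderAt hg 1 fun i hi => by
    interval_cases i
    simpa using h0
  exact_mod_cast this

variable (L : PeriodPair)

lemma analyticAt_weierstrassP {z : ℂ} (hz : z ∉ L.lattice) : AnalyticAt ℂ L.weierstrassP z :=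
  L.analyticOnNhd_weierstrassP z hz

lemma weierstrassP_add {z l : ℂ} (hl : l ∈ L.lattice) :
    L.weierstrassP (z + l) = L.weierstrassP z := L.weierstrassP_add_coe z ⟨l, hl⟩

lemma derivWeierstrassP_add {z l : ℂ} (hl : l ∈ L.lattice) :
    L.derivWeierstrassP (z + l) = L.derivWeierstrassP z := L.derivWeierstrassP_add_coe z ⟨l, hl⟩

lemma meromorphicOrderAt_weierstrassP_sub {z : ℂ} (hz : z ∈ L.lattice) (c : ℂ) :
    meromorphicOrderAt (fun z => L.weierstrassP z - c) z = -2 := by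
  have h1 := L.order_weierstrassP z hz
  have h2 : (0 : WithTop ℤ) ≤ meromorphicOrderAt (fun _ : ℂ => -c) z :=
    analyticAt_const.meromorphicOrderAt_nonneg
  have h3 := meromorphicOrderAt_add_eq_left_of_lt (f₁ := L.weierstrassP) (f₂ := fun _ : ℂ => -c)
    (MeromorphicAt.const _ z)
    (h1 ▸ lt_of_lt_of_le (by decide) h2)
  rw [h1] at h3
  rw [← h3]
  congr 1

lemma meromorphicAt_weierstrassP_sub (z c : ℂ) :
    MeromorphicAt (fun z => L.weierstrassP z - c) z :=
  (L.meromorphic_weierstrassP z).sub (MeromorphicAt.const c z)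

lemma derivWeierstrassP_half {w : ℂ} (hw2 : 2 * w ∈ L.lattice) : L.derivWeierstrassP w = 0 := by
  have h := derivWeierstrassP_add L (z := -w) hw2
  rw [show -w + 2 * w = w by ring, L.derivWeierstrassP_neg] at h
  linear_combination h / 2

/-! ### Half-period products and the separation of the values of `℘` -/

/-- The product `(℘(z) - ℘(w)) (℘(z + w) - ℘(w))` for a half period `w`. -/
def halfPeriodProd (w z : ℂ) : ℂ :=
  (L.weierstrassP z - L.weierstrassP w) * (L.weierstrassP (z + w) - L.weierstrassP w)

lemma meromorphicAt_halfPeriodProd (w z : ℂ) : MeromorphicAt (halfPeriodProd L w) z := by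
  refine (meromorphicAt_weierstrassP_sub L z _).fun_mul ?_
  exact (meromorphicAt_weierstrassP_sub L (z + w) (L.weierstrassP w)).comp_analyticAt
    (g := fun z => z + w) (by fun_prop)

/-- The shift swaps the two factors. It transports the analysis at lattice points to the other
possible poles, the points of `-w + L`. -/
lemma halfPeriodProd_add_half {w : ℂ} (hw2 : 2 * w ∈ L.lattice) (z : ℂ) :
    halfPeriodProd L w (z + w) = halfPeriodProd L w z := by
  have h := weierstrassP_add L (z := z) hw2
  simp only [halfPeriodProd]
  rw [show z + w + w = z + 2 * w by ring, h, mul_comm]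

/-- Since `℘'(w) = 0` at a half period, the second factor has at least a double zero here, which
cancels the double pole of the first. -/
lemma meromorphicOrderAt_halfPeriodProd_lattice {w : ℂ} (hw : w ∉ L.lattice)
    (hw2 : 2 * w ∈ L.lattice) {z : ℂ} (hz : z ∈ L.lattice) :
    0 ≤ meromorphicOrderAt (halfPeriodProd L w) z := by
  have hzw : z + w ∉ L.lattice := fun h => hw (by simpa using sub_mem h hz)
  have han := (analyticAt_weierstrassP L hzw)
  have han' : AnalyticAt ℂ (fun z => L.weierstrassP (z + w) - L.weierstrassP w) z :=
    (han.comp_of_eq (g := L.weierstrassP) (f := fun z => z + w) (by fun_prop) rfl).sub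
      analyticAt_const
  have h2 : 2 ≤ meromorphicOrderAt (fun z => L.weierstrassP (z + w) - L.weierstrassP w) z := by
    refine two_le_meromorphicOrderAt han' ?_ ?_
    · rw [add_comm, weierstrassP_add L hz, sub_self]
    · rw [deriv_sub_const, deriv_comp_add_const, L.deriv_weierstrassP, add_comm,
        derivWeierstrassP_add L hz, derivWeierstrassP_half L hw2]
  unfold halfPeriodProd
  rw [fun_meromorphicOrderAt_mul (meromorphicAt_weierstrassP_sub L z _) han'.meromorphicAt,
    meromorphicOrderAt_weierstrassP_sub L hz]
  calc (0 : WithTop ℤ) = -2 + 2 := by decide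
    _ ≤ _ := by gcongr

lemma analyticAt_halfPeriodProd {w z : ℂ} (hz : z ∉ L.lattice) (hzw : z + w ∉ L.lattice) :
    AnalyticAt ℂ (halfPeriodProd L w) z :=
  ((analyticAt_weierstrassP L hz).sub analyticAt_const).mul
    (((analyticAt_weierstrassP L hzw).comp_of_eq (g := L.weierstrassP) (f := fun z => z + w)
      (by fun_prop) rfl).sub analyticAt_const)

lemma meromorphicOrderAt_halfPeriodProd {w : ℂ} (hw : w ∉ L.lattice)
    (hw2 : 2 * w ∈ L.lattice) (z : ℂ) :
    0 ≤ meromorphicOrderAt (halfPeriodProd L w) z := by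
  by_cases hz : z ∈ L.lattice
  · exact meromorphicOrderAt_halfPeriodProd_lattice L hw hw2 hz
  by_cases hzw : z + w ∈ L.lattice
  · have h := meromorphicOrderAt_comp_add_const_eq_meromorphicOrderAt (x := z) (c := w)
      (f := halfPeriodProd L w)
    have h2 : halfPeriodProd L w ∘ (· + w) = halfPeriodProd L w :=
      funext fun z => halfPeriodProd_add_half L hw2 z
    rw [h2] at h
    rw [h]
    exact meromorphicOrderAt_halfPeriodProd_lattice L hw hw2 hzw
  · exact (analyticAt_halfPeriodProd L hz hzw).meromorphicOrderAt_nonneg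

/-- The product `(℘(z) - ℘(w)) (℘(z + w) - ℘(w))` is a nonzero constant. -/
lemma exists_halfPeriodProd_eq {w : ℂ} (hw : w ∉ L.lattice) (hw2 : 2 * w ∈ L.lattice) :
    ∃ c ≠ 0, ∀ z, z ∉ L.lattice → z + w ∉ L.lattice → halfPeriodProd L w z = c := by
  obtain ⟨c, hc, hc'⟩ := exists_eq_const_of_periodic L (halfPeriodProd L w)
    (meromorphicAt_halfPeriodProd L w) (meromorphicOrderAt_halfPeriodProd L hw hw2) (by
      refine fun z l hl => Eventually.of_forall fun z => ?_
      simp only [halfPeriodProd]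
      rw [weierstrassP_add L hl, show z + l + w = z + w + l by ring, weierstrassP_add L hl])
  refine ⟨c, ?_, fun z hz hzw => hc' z (analyticAt_halfPeriodProd L hz hzw).continuousAt⟩
  -- If the constant were 0, the product would vanish near 0 off the lattice, although each factor
  -- is nonzero on a punctured neighbourhood of 0.
  rintro rfl
  have hP : Meromorphic (fun z => L.weierstrassP z - L.weierstrassP w) :=
    fun z => meromorphicAt_weierstrassP_sub L z _
  have hne : ∀ z, meromorphicOrderAt (fun z => L.weierstrassP z - L.weierstrassP w) z ≠ ⊤ := by
    intro z
    refine MeromorphicOn.meromorphicOrderAt_ne_top_of_isPreconnected (U := Set.univ) (x := 0)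
      (fun z _ => hP z) isPreconnected_univ trivial trivial ?_
    rw [meromorphicOrderAt_weierstrassP_sub L (zero_mem _)]
    decide
  have h1 := (meromorphicOrderAt_ne_top_iff_eventually_ne_zero (hP 0)).mp (hne 0)
  have h2 := (meromorphicOrderAt_ne_top_iff_eventually_ne_zero (hP w)).mp (hne w)
  have h3 : ∀ᶠ z in 𝓝[≠] (0 : ℂ), L.weierstrassP (z + w) - L.weierstrassP w ≠ 0 := by
    have ht : Tendsto (fun z => z + w) (𝓝[≠] (0 : ℂ)) (𝓝[≠] w) := by
      refine tendsto_nhdsWithin_iff.mpr ⟨?_, ?_⟩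
      · have := (continuous_add_const w).tendsto 0
        rw [zero_add] at this
        exact this.mono_left nhdsWithin_le_nhds
      · filter_upwards [self_mem_nhdsWithin] with v hv
        simpa using hv
    exact ht.eventually h2
  have h4 : ∀ᶠ z in 𝓝[≠] (0 : ℂ), z ∉ L.lattice ∧ z + w ∉ L.lattice := by
    have h5 : ∀ᶠ z in 𝓝[≠] (0 : ℂ), z ∉ L.lattice := by
      rw [eventually_nhdsWithin_iff]
      filter_upwards [L.compl_lattice_sdiff_singleton_mem_nhds 0] with z hz hz0 hzL
      exact hz ⟨hzL, hz0⟩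
    have h6 : ∀ᶠ z in 𝓝[≠] (0 : ℂ), z + w ∉ L.lattice := by
      have : ∀ᶠ v in 𝓝 (0 + w), v ∉ L.lattice := by
        rw [zero_add]
        exact L.isClosed_lattice.isOpen_compl.mem_nhds hw
      exact ((continuous_add_const w).tendsto 0 |>.mono_left nhdsWithin_le_nhds).eventually this
    exact h5.and h6
  obtain ⟨z, ⟨ha, hb⟩, hz, hzw⟩ := ((h1.and h3).and h4).exists
  have := hc' z (analyticAt_halfPeriodProd L hz hzw).continuousAt
  rcases mul_eq_zero.mp this with h | h
  exacts [ha h, hb h]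

lemma weierstrassP_ne_half {w z : ℂ} (hw : w ∉ L.lattice) (hw2 : 2 * w ∈ L.lattice)
    (hz : z ∉ L.lattice) (hzw : z + w ∉ L.lattice) : L.weierstrassP z ≠ L.weierstrassP w := by
  obtain ⟨c, hc0, hc⟩ := exists_halfPeriodProd_eq L hw hw2
  intro h
  apply hc0
  rw [← hc z hz hzw, halfPeriodProd, h, sub_self, zero_mul]

end

section

/-! ### The Weierstrass zeta function -/

variable (L : PeriodPair)

/-- The summand of the Weierstrass zeta function. -/
def zetaTerm (l z : ℂ) : ℂ := 1 / (z - l) + 1 / l + z / l ^ 2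

/-- The Weierstrass zeta function of a lattice. -/
def zetaL (z : ℂ) : ℂ := ∑' l : L.lattice, zetaTerm l z

/-- The Weierstrass zeta function without the summand at `l₀`. -/
def zetaExcept (l₀ z : ℂ) : ℂ := ∑' l : L.lattice, if l.1 = l₀ then 0 else zetaTerm l z

lemma wzeta_eq (τ : ℍ) : wzeta τ = zetaL (periods τ) := rfl

/-- The three fractions combine to `z² / (l² (z - l))`, of size `‖l‖⁻³`, which is summable over a
lattice of rank 2. -/
lemma norm_zetaTerm_le {r : ℝ} {z l : ℂ} (hr : 0 < r) (hz : ‖z‖ < r) (h : 2 * r ≤ ‖l‖) :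
    ‖zetaTerm l z‖ ≤ 2 * r ^ 2 * ‖l‖ ^ (-3 : ℝ) := by
  have hl0 : 0 < ‖l‖ := by linarith
  have hl : l ≠ 0 := norm_pos_iff.mp hl0
  have h2 : ‖l‖ / 2 ≤ ‖z - l‖ := by
    have := norm_sub_norm_le l z
    rw [norm_sub_rev] at this
    linarith
  have hzl : z - l ≠ 0 := norm_pos_iff.mp (by linarith)
  have h1 : zetaTerm l z = z ^ 2 / (l ^ 2 * (z - l)) := by
    unfold zetaTerm
    field_simp
    ring
  calc ‖zetaTerm l z‖ = ‖z‖ ^ 2 / (‖l‖ ^ 2 * ‖z - l‖) := by rw [h1]; simp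
    _ ≤ r ^ 2 / (‖l‖ ^ 2 * (‖l‖ / 2)) := by gcongr
    _ = 2 * r ^ 2 / ‖l‖ ^ 3 := by field
    _ = _ := by norm_cast

lemma hasSumLocallyUniformly_zetaExcept (l₀ : ℂ) :
    HasSumLocallyUniformly
      (fun (l : L.lattice) (z : ℂ) ↦ if l.1 = l₀ then 0 else zetaTerm l z) (zetaExcept L l₀) := by
  refine L.hasSumLocallyUniformly_aux (u := fun r l => 2 * r ^ 2 * ‖l‖ ^ (-3 : ℝ)) _
    (fun _ _ ↦ (ZLattice.summable_norm_rpow _ _ (by simp; norm_num)).mul_left _) fun r hr ↦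
    Filter.eventually_atTop.mpr ⟨2 * r, ?_⟩
  rintro _ h s hs l rfl
  split_ifs
  · rw [norm_zero]; positivity
  · exact norm_zetaTerm_le hr hs h

lemma hasDerivAt_zetaTerm {l z : ℂ} (h : z ≠ l) :
    HasDerivAt (zetaTerm l) (-(1 / (z - l) ^ 2 - 1 / l ^ 2)) z := by
  have h1 := ((hasDerivAt_id z).sub_const l).inv (sub_ne_zero.mpr h)
  have h2 := (h1.add_const (1 / l)).add ((hasDerivAt_id z).div_const (l ^ 2))
  refine (h2.congr_of_eventuallyEq (Eventually.of_forall fun w => ?_)).congr_deriv ?_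
  · simp [zetaTerm]
  · simp; ring

lemma hasDerivAt_zetaExceptTerm {l₀ z : ℂ} (h : z ∈ ((L.lattice : Set ℂ) \ {l₀})ᶜ)
    (l : L.lattice) :
    HasDerivAt (fun z => if l.1 = l₀ then 0 else zetaTerm l z)
      (-(if l.1 = l₀ then 0 else (1 / (z - l) ^ 2 - 1 / l ^ 2))) z := by
  split_ifs with hl
  · simpa using hasDerivAt_const z (0 : ℂ)
  · refine hasDerivAt_zetaTerm ?_
    rintro rfl
    exact h ⟨l.2, hl⟩

lemma differentiableOn_zetaExcept (l₀ : ℂ) :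
    DifferentiableOn ℂ (zetaExcept L l₀) ((L.lattice : Set ℂ) \ {l₀})ᶜ :=
  (hasSumLocallyUniformly_zetaExcept L l₀).hasSumLocallyUniformlyOn.differentiableOn
    (.of_forall fun _ ↦ .fun_sum fun i _ _ hz ↦
      (hasDerivAt_zetaExceptTerm L hz i).differentiableAt.differentiableWithinAt)
    L.isOpen_compl_lattice_sdiff

lemma deriv_zetaExcept {l₀ z : ℂ} (hz : z ∈ ((L.lattice : Set ℂ) \ {l₀})ᶜ) :
    deriv (zetaExcept L l₀) z = -L.weierstrassPExcept l₀ z := by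
  have h := ((hasSumLocallyUniformly_zetaExcept L l₀).tendstoLocallyUniformlyOn.deriv
    (.of_forall fun s ↦ .fun_sum fun i _ _ hz ↦
      (hasDerivAt_zetaExceptTerm L hz i).differentiableAt.differentiableWithinAt)
    L.isOpen_compl_lattice_sdiff).tendsto_at hz
  refine tendsto_nhds_unique h ((L.hasSum_weierstrassPExcept l₀ z).neg.congr fun s => ?_)
  exact (HasDerivAt.fun_sum fun i _ => hasDerivAt_zetaExceptTerm L hz i).deriv.symm

lemma summable_zetaTerm (z : ℂ) : Summable fun l : L.lattice => zetaTerm l z := by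
  have h := (hasSumLocallyUniformly_zetaExcept L (L.ω₁ / 2)).hasSum (x := z) |>.summable
  refine h.congr fun l => ?_
  rw [if_neg]
  exact fun e ↦ L.ω₁_div_two_notMem_lattice (e ▸ l.2)

lemma zetaExcept_add {l₀ : ℂ} (hl₀ : l₀ ∈ L.lattice) (z : ℂ) :
    zetaExcept L l₀ z + zetaTerm l₀ z = zetaL L z := by
  classical
  unfold zetaL zetaExcept
  rw [(summable_zetaTerm L z).tsum_eq_add_tsum_ite ⟨l₀, hl₀⟩, add_comm]
  congr 2
  ext l
  simp [Subtype.ext_iff]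

lemma zetaL_neg (z : ℂ) : zetaL L (-z) = -zetaL L z := by
  unfold zetaL
  rw [← (Equiv.neg L.lattice).tsum_eq, ← tsum_neg]
  congr with l
  simp only [zetaTerm, Equiv.neg_apply, NegMemClass.coe_neg]
  rw [show -z - -(l : ℂ) = -(z - l) by ring]
  simp only [one_div, inv_neg, neg_sq]
  ring

lemma hasDerivAt_zetaL {z : ℂ} (hz : z ∉ L.lattice) :
    HasDerivAt (zetaL L) (-L.weierstrassP z) z := by
  have hmem : z ∈ ((L.lattice : Set ℂ) \ {0})ᶜ := fun h => hz h.1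
  have h1 := ((differentiableOn_zetaExcept L 0).differentiableAt
    (L.isOpen_compl_lattice_sdiff.mem_nhds hmem)).hasDerivAt
  rw [deriv_zetaExcept L hmem] at h1
  have h2 := h1.add (hasDerivAt_zetaTerm (l := 0) (z := z) (by rintro rfl; exact hz (zero_mem _)))
  refine (h2.congr_of_eventuallyEq (Eventually.of_forall fun w => ?_)).congr_deriv ?_
  · exact (zetaExcept_add L (zero_mem _) w).symm
  · have := L.weierstrassPExcept_add 0 z
    simp only [ZeroMemClass.coe_zero] at this
    linear_combination -this

lemma analyticAt_zetaL {z : ℂ} (hz : z ∉ L.lattice) : AnalyticAt ℂ (zetaL L) z := by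
  have : DifferentiableOn ℂ (zetaL L) (L.lattice : Set ℂ)ᶜ := fun w hw =>
    (hasDerivAt_zetaL L hw).differentiableAt.differentiableWithinAt
  exact this.analyticAt (L.isClosed_lattice.isOpen_compl.mem_nhds hz)

lemma analyticAt_zetaExcept (l₀ : ℂ) : AnalyticAt ℂ (zetaExcept L l₀) l₀ :=
  (differentiableOn_zetaExcept L l₀).analyticAt
    (L.isOpen_compl_lattice_sdiff.mem_nhds (by simp))

lemma zetaL_eq {l₀ : ℂ} (hl₀ : l₀ ∈ L.lattice) :
    zetaL L = (fun z => (z - l₀) ^ (-1 : ℤ)) + fun z =>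
      (zetaExcept L l₀ z + 1 / l₀ + z * (1 / l₀ ^ 2)) := by
  ext z
  rw [← zetaExcept_add L hl₀, zetaTerm]
  simp
  ring

lemma analyticAt_zetaL_regularPart (l₀ : ℂ) : AnalyticAt ℂ (fun z =>
    (zetaExcept L l₀ z + 1 / l₀ + z * (1 / l₀ ^ 2))) l₀ :=
  ((analyticAt_zetaExcept L l₀).add analyticAt_const).add
    (analyticAt_id.mul analyticAt_const)

lemma meromorphicAt_zetaL (z : ℂ) : MeromorphicAt (zetaL L) z := by
  by_cases hz : z ∈ L.lattice
  · rw [zetaL_eq L hz]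
    exact MeromorphicAt.add (by fun_prop) (analyticAt_zetaL_regularPart L z).meromorphicAt
  · exact (analyticAt_zetaL L hz).meromorphicAt

lemma neg_one_le_meromorphicOrderAt_zetaL (z : ℂ) : -1 ≤ meromorphicOrderAt (zetaL L) z := by
  have hneg : (-1 : WithTop ℤ) ≤ 0 := by decide
  by_cases hz : z ∈ L.lattice
  · rw [zetaL_eq L hz]
    refine le_trans (le_min ?_ ?_) (meromorphicOrderAt_add (by fun_prop)
      (analyticAt_zetaL_regularPart L z).meromorphicAt)
    · rw [fun_meromorphicOrderAt_zpow_id_sub_const]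
      exact le_of_eq (by decide)
    · exact hneg.trans (analyticAt_zetaL_regularPart L z).meromorphicOrderAt_nonneg
  · exact hneg.trans (analyticAt_zetaL L hz).meromorphicOrderAt_nonneg

/-- The residue of `ζ` at 0, which later fixes the constant in the addition formula. -/
lemma tendsto_mul_zetaL : Tendsto (fun z => z * zetaL L z) (𝓝[≠] 0) (𝓝 1) := by
  have h1 : ContinuousAt (fun z => 1 + z * (zetaExcept L 0 z + 1 / 0 + z * (1 / 0 ^ 2))) 0 :=
    (continuousAt_const.add (continuousAt_id.mul (analyticAt_zetaL_regularPart L 0).continuousAt))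
  have h2 := h1.tendsto
  simp only [zero_mul, add_zero] at h2
  refine (h2.mono_left nhdsWithin_le_nhds).congr' ?_
  filter_upwards [self_mem_nhdsWithin] with z hz
  rw [zetaL_eq L (zero_mem _)]
  have : z ≠ 0 := hz
  simp
  field_simp

/-- The quasi-periodicity of the Weierstrass zeta function. -/
lemma exists_zetaL_add {l : ℂ} (hl : l ∈ L.lattice) :
    ∃ η, ∀ z, z ∉ L.lattice → zetaL L (z + l) = zetaL L z + η := by
  -- Removing a countable set does not disconnect the plane, so a vanishing derivative yields one
  -- constant for all `z` off the lattice.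
  have hconn : IsPreconnected (L.lattice : Set ℂ)ᶜ :=
    (Set.Countable.isConnected_compl_of_one_lt_rank (by simp)
      (countable_of_Lindelof_of_discrete (X := L.lattice))).2
  have hd : ∀ z ∈ (L.lattice : Set ℂ)ᶜ,
      HasDerivAt (fun z => zetaL L (z + l) - zetaL L z) 0 z := by
    intro z hz
    have hzl : z + l ∉ L.lattice := fun h => hz (by simpa using sub_mem h hl)
    have h1 := (hasDerivAt_zetaL L hzl).comp_add_const z l
    rw [weierstrassP_add L hl] at h1
    exact (h1.fun_sub (hasDerivAt_zetaL L hz)).congr_deriv (sub_self _)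
  obtain ⟨η, hη⟩ := L.isClosed_lattice.isOpen_compl.exists_is_const_of_deriv_eq_zero hconn
    (fun z hz => (hd z hz).differentiableAt.differentiableWithinAt)
    (fun z hz => (hd z hz).deriv)
  exact ⟨η, fun z hz => by linear_combination hη z hz⟩

/-! ### The addition formula for `ζ` -/

/-- The difference `ζ(z + a) - ζ(z - a) - 2 ζ(a)`. -/
def zetaDiff (a z : ℂ) : ℂ := zetaL L (z + a) - zetaL L (z - a) - 2 * zetaL L a

variable {L} {a : ℂ}

lemma analyticAt_zetaDiff {z : ℂ} (h1 : z + a ∉ L.lattice) (h2 : z - a ∉ L.lattice) :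
    AnalyticAt ℂ (zetaDiff L a) z :=
  (((analyticAt_zetaL L h1).comp_of_eq (g := zetaL L) (f := fun z => z + a) (by fun_prop) rfl).sub
    ((analyticAt_zetaL L h2).comp_of_eq (g := zetaL L) (f := fun z => z - a)
      (by fun_prop) rfl)).sub analyticAt_const

lemma meromorphicAt_zetaL_comp_add (b z : ℂ) : MeromorphicAt (fun z => zetaL L (z + b)) z :=
  (meromorphicAt_zetaL L (z + b)).comp_analyticAt (g := fun z => z + b) (by fun_prop)

lemma meromorphicAt_zetaDiff (z : ℂ) : MeromorphicAt (zetaDiff L a) z :=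
  ((meromorphicAt_zetaL_comp_add a z).sub
    (by simpa [sub_eq_add_neg] using meromorphicAt_zetaL_comp_add (L := L) (-a) z)).sub
    (MeromorphicAt.const _ _)

lemma neg_one_le_meromorphicOrderAt_zetaDiff (z : ℂ) :
    -1 ≤ meromorphicOrderAt (zetaDiff L a) z := by
  have hz (b : ℂ) : -1 ≤ meromorphicOrderAt (fun z => zetaL L (z + b)) z := by
    rw [meromorphicOrderAt_fun_comp_add_const_eq_meromorphicOrderAt]
    exact neg_one_le_meromorphicOrderAt_zetaL L _
  have e : zetaDiff L a = (fun z => zetaL L (z + a)) + -(fun z => zetaL L (z + -a))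
      + fun _ => -(2 * zetaL L a) := by
    ext z; simp [zetaDiff, sub_eq_add_neg]
  rw [e]
  have m1 := meromorphicAt_zetaL_comp_add (L := L) a z
  have m2 := (meromorphicAt_zetaL_comp_add (L := L) (-a) z).neg
  refine le_trans (le_min (le_trans (le_min (hz a) ?_) (meromorphicOrderAt_add m1 m2)) ?_)
    (meromorphicOrderAt_add (m1.add m2) (MeromorphicAt.const _ _))
  · rw [← meromorphicOrderAt_neg]
    exact hz (-a)
  · exact le_trans (by decide) (analyticAt_const (𝕜 := ℂ)).meromorphicOrderAt_nonneg

lemma zetaDiff_lattice (ha : a ∉ L.lattice) {l : ℂ} (hl : l ∈ L.lattice) :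
    zetaDiff L a l = 0 := by
  obtain ⟨η, hη⟩ := exists_zetaL_add L hl
  have h1 := hη a ha
  have h2 := hη (-a) (fun h => ha (by simpa using neg_mem h))
  rw [zetaL_neg] at h2
  rw [zetaDiff, add_comm l a, show l - a = -a + l by ring, h1, h2]
  ring

lemma deriv_zetaDiff_lattice (ha : a ∉ L.lattice) {l : ℂ} (hl : l ∈ L.lattice) :
    deriv (zetaDiff L a) l = 0 := by
  have h1 : l + a ∉ L.lattice := fun h => ha (by simpa using sub_mem h hl)
  have h2 : l - a ∉ L.lattice := fun h => ha (by simpa using sub_mem hl h)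
  have d1 := (hasDerivAt_zetaL L h1).comp_add_const l a
  have d2 := (hasDerivAt_zetaL L h2).comp_sub_const l a
  have := ((d1.sub d2).sub_const (2 * zetaL L a)).deriv
  refine Eq.trans this ?_
  rw [add_comm l a, weierstrassP_add L hl, show l - a = -a + l by ring, weierstrassP_add L hl,
    L.weierstrassP_neg, sub_self]

/-- At lattice points a zero of order at least two of `zetaDiff` cancels the double pole of `℘`. The
at most simple poles of `zetaDiff` lie at `±a` modulo the lattice, where `℘ - ℘(a)` vanishes. -/
lemma meromorphicOrderAt_zetaDiff_mul_nonneg (ha : a ∉ L.lattice) (z : ℂ) :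
    0 ≤ meromorphicOrderAt (fun z => zetaDiff L a z * (L.weierstrassP z - L.weierstrassP a)) z := by
  have mP := meromorphicAt_weierstrassP_sub L z (L.weierstrassP a)
  rw [fun_meromorphicOrderAt_mul (meromorphicAt_zetaDiff z) mP]
  by_cases hz : z ∈ L.lattice
  · have h1 : z + a ∉ L.lattice := fun h => ha (by simpa using sub_mem h hz)
    have h2 : z - a ∉ L.lattice := fun h => ha (by simpa using sub_mem hz h)
    have := two_le_meromorphicOrderAt (analyticAt_zetaDiff h1 h2) (zetaDiff_lattice ha hz)
      (deriv_zetaDiff_lattice ha hz)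
    rw [meromorphicOrderAt_weierstrassP_sub L hz]
    calc (0 : WithTop ℤ) = 2 + -2 := by decide
      _ ≤ _ := by gcongr
  have hP := (analyticAt_weierstrassP L hz).sub (analyticAt_const (v := L.weierstrassP a))
  by_cases h : L.weierstrassP z = L.weierstrassP a
  · have h1 : 1 ≤ meromorphicOrderAt (fun z => L.weierstrassP z - L.weierstrassP a) z :=
      one_le_meromorphicOrderAt hP (by simp [h])
    calc (0 : WithTop ℤ) = -1 + 1 := by decide
      _ ≤ _ := by gcongr; exact neg_one_le_meromorphicOrderAt_zetaDiff z
  · have h1 : z + a ∉ L.lattice := by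
      intro hl
      apply h
      have := weierstrassP_add L (z := -a) hl
      rwa [show -a + (z + a) = z by ring, L.weierstrassP_neg] at this
    have h2 : z - a ∉ L.lattice := by
      intro hl
      apply h
      have := weierstrassP_add L (z := a) hl
      rwa [show a + (z - a) = z by ring] at this
    exact add_nonneg (analyticAt_zetaDiff h1 h2).meromorphicOrderAt_nonneg
      (AnalyticAt.meromorphicOrderAt_nonneg hP)

lemma eventually_add_notMem_lattice (b z : ℂ) : ∀ᶠ w in 𝓝[≠] z, w + b ∉ L.lattice := by
  rw [eventually_nhdsWithin_iff]
  have := (continuous_add_const b).tendsto z (L.compl_lattice_sdiff_singleton_mem_nhds (z + b))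
  filter_upwards [this] with w hw hne hL
  exact hw ⟨hL, by simpa using hne⟩

/-- The addition formula `(ζ(z + a) - ζ(z - a) - 2 ζ(a)) (℘(z) - ℘(a)) = - ℘'(a)`. -/
lemma zetaDiff_mul (ha : a ∉ L.lattice) (ha2 : 2 * a ∉ L.lattice) {z : ℂ} (hz : z ∉ L.lattice)
    (h1 : z + a ∉ L.lattice) (h2 : z - a ∉ L.lattice) :
    zetaDiff L a z * (L.weierstrassP z - L.weierstrassP a) = -L.derivWeierstrassP a := by
  obtain ⟨c, hc, hc'⟩ := exists_eq_const_of_periodic L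
    (fun z => zetaDiff L a z * (L.weierstrassP z - L.weierstrassP a))
    (fun z => (meromorphicAt_zetaDiff z).mul (meromorphicAt_weierstrassP_sub L z _))
    (meromorphicOrderAt_zetaDiff_mul_nonneg ha) (by
      intro z l hl
      obtain ⟨η, hη⟩ := exists_zetaL_add L hl
      filter_upwards [eventually_add_notMem_lattice (L := L) a z,
        eventually_add_notMem_lattice (L := L) (-a) z] with w hw1 hw2
      rw [weierstrassP_add L hl, zetaDiff, zetaDiff, show w + l + a = w + a + l by ring,
        show w + l - a = w + -a + l by ring, hη _ hw1, hη _ hw2, ← sub_eq_add_neg]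
      ring)
  have hval := hc' z (((analyticAt_zetaDiff h1 h2).mul
    ((analyticAt_weierstrassP L hz).sub analyticAt_const)).continuousAt)
  -- The constant is read off as `z → a`: there `(z - a) zetaDiff` tends to `-1`, as `2a` is not a
  -- pole of `ζ`, and the difference quotient of `℘` tends to `℘'(a)`.
  refine hval.trans (tendsto_nhds_unique (hc a) ?_)
  have t1 : Tendsto (fun z => (z - a) * zetaDiff L a z) (𝓝[≠] a) (𝓝 (-1)) := by
    have ts : Tendsto (fun z => z - a) (𝓝[≠] a) (𝓝[≠] 0) := by
      refine tendsto_nhdsWithin_iff.mpr ⟨?_, ?_⟩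
      · have := (continuous_sub_right a).tendsto a
        rw [sub_self] at this
        exact this.mono_left nhdsWithin_le_nhds
      · filter_upwards [self_mem_nhdsWithin] with v hv
        simpa [sub_eq_zero] using hv
    have u1 := (tendsto_mul_zetaL L).comp ts
    have haa : a + a ∉ L.lattice := by rwa [← two_mul]
    have c2 : ContinuousAt (fun z => (z - a) * (zetaL L (z + a) - 2 * zetaL L a)) a :=
      (by fun_prop : ContinuousAt (fun z => z - a) a).mul
        (((analyticAt_zetaL L haa).continuousAt.comp_of_eq (g := zetaL L) (f := fun z => z + a)
          (by fun_prop) rfl).sub continuousAt_const)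
    have u2 := c2.tendsto.mono_left (nhdsWithin_le_nhds (s := {a}ᶜ))
    have u3 := u2.sub u1
    simp only [sub_self, zero_mul, zero_sub] at u3
    refine u3.congr fun w => ?_
    simp only [zetaDiff, Function.comp]
    ring
  have t2 : Tendsto (slope L.weierstrassP a) (𝓝[≠] a) (𝓝 (L.derivWeierstrassP a)) := by
    have := (analyticAt_weierstrassP L ha).differentiableAt.hasDerivAt
    rw [L.deriv_weierstrassP] at this
    exact hasDerivAt_iff_tendsto_slope.mp this
  have t3 := t1.mul t2
  rw [neg_one_mul] at t3
  refine t3.congr' ?_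
  filter_upwards [self_mem_nhdsWithin] with w hw
  have : w - a ≠ 0 := sub_ne_zero.mpr hw
  rw [slope_def_field]
  field_simp

end

/-! ### Row sums -/

/-- The function `π² / sin² (π z)`, equal to `∑_{m ∈ ℤ} 1 / (z + m)²` off the integers. -/
def cscSq (z : ℂ) : ℂ := (Real.pi : ℂ) ^ 2 / Complex.sin (Real.pi * z) ^ 2

lemma cscSq_neg (z : ℂ) : cscSq (-z) = cscSq z := by simp [cscSq]

lemma sin_pi_mul_ne_zero_of_forall {z : ℂ} (hz : ∀ n : ℤ, z ≠ n) :
    Complex.sin (Real.pi * z) ≠ 0 := by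
  apply Complex.sin_ne_zero_iff.2
  intro k h
  apply hz k
  have hpi : (Real.pi : ℂ) ≠ 0 := by exact_mod_cast Real.pi_ne_zero
  exact mul_left_cancel₀ hpi (by rw [h, mul_comm])

lemma differentiableAt_cscSq {z : ℂ} (hz : ∀ n : ℤ, z ≠ n) : DifferentiableAt ℂ cscSq z := by
  unfold cscSq
  have := pow_ne_zero 2 (sin_pi_mul_ne_zero_of_forall hz)
  fun_prop (disch := assumption)

lemma ne_intCast_of_im_ne_zero {z : ℂ} (hz : z.im ≠ 0) (n : ℤ) : z ≠ n := by
  rintro rfl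
  simp at hz

/-- From `|sin(x + iy)|² = sin² x + sinh² y`. This weak bound already makes the row sums converge
like `∑ 1 / n²`. -/
lemma norm_sin_ge (z : ℂ) : |z.im| ≤ ‖Complex.sin z‖ := by
  have h : ‖Complex.sin z‖ ^ 2 = Real.sin z.re ^ 2 + Real.sinh z.im ^ 2 := by
    rw [Complex.sin_eq, ← Complex.normSq_eq_norm_sq]
    have : (Complex.sin z.re * Complex.cosh z.im + Complex.cos z.re * Complex.sinh z.im * Complex.I)
      = ((Real.sin z.re * Real.cosh z.im : ℝ) : ℂ)
        + ((Real.cos z.re * Real.sinh z.im : ℝ) : ℂ) * Complex.I := by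
      push_cast; ring
    rw [this, Complex.normSq_add_mul_I]
    have h1 := Real.cosh_sq z.im
    have h2 := Real.sin_sq_add_cos_sq z.re
    linear_combination Real.sin z.re ^ 2 * h1 + Real.sinh z.im ^ 2 * h2
  have h3 : |z.im| ≤ |Real.sinh z.im| := by
    rcases le_total 0 z.im with h0 | h0
    · rw [abs_of_nonneg h0]
      exact (Real.self_le_sinh_iff.mpr h0).trans (le_abs_self _)
    · rw [abs_of_nonpos h0]
      exact (neg_le_neg (Real.sinh_le_self_iff.mpr h0)).trans (neg_le_abs _)
  refine h3.trans (abs_le_of_sq_le_sq ?_ (norm_nonneg _))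
  rw [h]
  nlinarith [sq_nonneg (Real.sin z.re)]

lemma norm_cscSq_le {z : ℂ} (hz : z.im ≠ 0) : ‖cscSq z‖ ≤ 1 / z.im ^ 2 := by
  have h := norm_sin_ge (Real.pi * z)
  rw [Complex.im_ofReal_mul, abs_mul, abs_of_pos Real.pi_pos] at h
  have hpos : 0 < |z.im| := abs_pos.mpr hz
  have hpi := Real.pi_pos
  rw [cscSq, norm_div, norm_pow, norm_pow, Complex.norm_real, Real.norm_of_nonneg hpi.le]
  calc Real.pi ^ 2 / ‖Complex.sin (Real.pi * z)‖ ^ 2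
      ≤ Real.pi ^ 2 / (Real.pi * |z.im|) ^ 2 := by gcongr
    _ = 1 / z.im ^ 2 := by rw [mul_pow, sq_abs]; field_simp

/-- The derivative of the partial fraction expansion of `π cot(π z)`. -/
lemma tsum_one_div_sq_of_im_pos {z : ℂ} (hz : 0 < z.im) :
    ∑' m : ℤ, 1 / (z + m) ^ 2 = cscSq z := by
  have h := iteratedDerivWithin_cot_pi_mul_eq_mul_tsum_div_pow (k := 1) le_rfl (z := z) hz
  rw [iteratedDerivWithin_one, derivWithin_of_isOpen isOpen_upperHalfPlaneSet hz] at h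
  have hs := sin_pi_mul_ne_zero_of_forall (ne_intCast_of_im_ne_zero hz.ne')
  have hd : HasDerivAt (fun z : ℂ => (Real.pi : ℂ) * Complex.cot (Real.pi * z)) (-cscSq z) z := by
    have h0 : HasDerivAt (fun z : ℂ => (Real.pi : ℂ) * z) Real.pi z := by
      simpa using (hasDerivAt_id z).const_mul (Real.pi : ℂ)
    have h1 := ((h0.ccos.div h0.csin hs).const_mul (Real.pi : ℂ))
    refine (h1.congr_of_eventuallyEq (Eventually.of_forall fun w => ?_)).congr_deriv ?_
    · simp [Complex.cot]
    · have h2 := Complex.sin_sq_add_cos_sq (Real.pi * z)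
      rw [cscSq, ← neg_div, mul_div_assoc']
      congr 1
      linear_combination -(Real.pi : ℂ) ^ 2 * h2
  rw [hd.deriv] at h
  simp only [pow_one, Nat.factorial_one, Nat.cast_one] at h
  linear_combination h

lemma norm_one_div_sq_le {x ε : ℝ} (hx : x ≠ 0) :
    ‖1 / ((x : ℂ) + ε * Complex.I) ^ 2‖ ≤ 1 / |x| ^ (2 : ℝ) := by
  rw [norm_div, norm_one, norm_pow, Real.rpow_two]
  have h := Complex.abs_re_le_norm ((x : ℂ) + ε * Complex.I)
  simp only [Complex.add_re, Complex.ofReal_re, Complex.mul_re, Complex.I_re, Complex.ofReal_im,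
    Complex.I_im, mul_zero, zero_mul, sub_zero, add_zero] at h
  have : 0 < |x| := abs_pos.mpr hx
  gcongr

/-- Boundary values of the identity on the upper half plane: let `ε → 0⁺` in `x + iε`, with
dominating series `∑ 1 / |m + x|²`. -/
lemma tsum_one_div_sq_of_real {x : ℝ} (hx : ∀ n : ℤ, (x : ℂ) ≠ n) :
    ∑' m : ℤ, 1 / ((x : ℂ) + m) ^ 2 = cscSq x := by
  have hx' (m : ℤ) : (x : ℂ) + m ≠ 0 := fun h =>
    hx (-m) (by push_cast; linear_combination h)
  have ht : Tendsto (fun ε : ℝ => (x : ℂ) + ε * Complex.I) (𝓝[>] 0) (𝓝 x) := by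
    have : Continuous (fun ε : ℝ => (x : ℂ) + ε * Complex.I) := by fun_prop
    have := this.tendsto 0
    simp only [Complex.ofReal_zero, zero_mul, add_zero] at this
    exact this.mono_left nhdsWithin_le_nhds
  have h1 := tendsto_tsum_of_dominated_convergence (𝓕 := 𝓝[>] (0 : ℝ))
    (f := fun ε (m : ℤ) => 1 / (((x : ℂ) + ε * Complex.I) + m) ^ 2)
    (g := fun m => 1 / ((x : ℂ) + m) ^ 2)
    (bound := fun m : ℤ => 1 / |(m : ℝ) + x| ^ (2 : ℝ))
    ((Real.summable_one_div_int_add_rpow x 2).mpr one_lt_two)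
    (fun m => ((continuousAt_const (y := (1 : ℂ))).div (by fun_prop)
      (pow_ne_zero 2 (hx' m)) : ContinuousAt (fun w : ℂ => 1 / (w + m) ^ 2) x).tendsto.comp ht)
    (Eventually.of_forall fun ε m => by
      have := norm_one_div_sq_le (x := m + x) (ε := ε)
        (by intro h; apply hx' m; rw [add_comm]; exact_mod_cast h)
      rwa [show ((m + x : ℝ) : ℂ) + ε * Complex.I = x + ε * Complex.I + m by push_cast; ring]
        at this)
  have h2 : Tendsto (fun ε : ℝ => cscSq ((x : ℂ) + ε * Complex.I)) (𝓝[>] 0) (𝓝 (cscSq x)) :=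
    (differentiableAt_cscSq hx).continuousAt.tendsto.comp ht
  refine tendsto_nhds_unique h1 (h2.congr' ?_)
  filter_upwards [self_mem_nhdsWithin] with ε hε
  exact (tsum_one_div_sq_of_im_pos (by simpa using hε)).symm

lemma tsum_one_div_sq {z : ℂ} (hz : ∀ n : ℤ, z ≠ n) :
    ∑' m : ℤ, 1 / (z + m) ^ 2 = cscSq z := by
  rcases lt_trichotomy z.im 0 with h | h | h
  · rw [← cscSq_neg, ← tsum_one_div_sq_of_im_pos (z := -z) (by simpa using h),
      ← (Equiv.neg ℤ).tsum_eq]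
    congr with m
    simp only [Equiv.neg_apply, Int.cast_neg]
    rw [show z + -(m : ℂ) = -(-z + m) by ring, neg_sq]
  · have : z = (z.re : ℂ) := Complex.ext (by simp) (by simp [h])
    rw [this] at hz ⊢
    exact tsum_one_div_sq_of_real hz
  · exact tsum_one_div_sq_of_im_pos h

lemma hasSum_one_div_sq {z : ℂ} (hz : ∀ n : ℤ, z ≠ n) :
    HasSum (fun m : ℤ => 1 / (z - m) ^ 2) (cscSq z) := by
  have hs : Summable fun m : ℤ => 1 / (z + m) ^ 2 := by
    refine (EisensteinSeries.linear_right_summable z 1 (k := 2) le_rfl).congr fun m => ?_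
    simp
  have h := (Equiv.neg ℤ).hasSum_iff.mpr (tsum_one_div_sq hz ▸ hs.hasSum)
  refine h.congr_fun fun m => ?_
  simp [sub_eq_add_neg]

/-- The differences of values of `℘` as sums over rows of the lattice. -/
lemma hasSum_wp_sub (τ : ℍ) {z w : ℂ} (hz : z ∉ (periods τ).lattice)
    (hw : w ∉ (periods τ).lattice) :
    HasSum (fun n : ℤ => cscSq (z - n * τ) - cscSq (w - n * τ)) (wp τ z - wp τ w) := by
  have h := ((periods τ).hasSum_weierstrassP z).sub ((periods τ).hasSum_weierstrassP w)
  -- The factors are swapped so that the fibres are the rows, with a fixed coefficient of `τ`. In a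
  -- difference of two values of `℘` the corrections `1 / ω²` cancel.
  let e : ℤ × ℤ ≃ (periods τ).lattice :=
    (Equiv.prodComm ℤ ℤ).trans (periods τ).latticeEquivProd.symm.toEquiv
  have he (x : ℤ × ℤ) : ((e x : (periods τ).lattice) : ℂ) = x.2 + x.1 * τ := by
    have := (periods τ).latticeEquiv_symm_apply (x.2, x.1)
    refine this.trans ?_
    simp [periods]
  have h' := e.hasSum_iff.mpr h
  refine h'.prod_fiberwise fun n => ?_
  have hrow {u : ℂ} (hu : u ∉ (periods τ).lattice) (m : ℤ) : u - n * τ ≠ m := by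
    intro h
    apply hu
    rw [show u = ((e (n, m) : (periods τ).lattice) : ℂ) by rw [he]; linear_combination h]
    exact Subtype.coe_prop _
  refine ((hasSum_one_div_sq (hrow hz)).sub (hasSum_one_div_sq (hrow hw))).congr_fun fun m => ?_
  simp only [Function.comp, he]
  rw [show z - ((m : ℂ) + n * τ) = z - n * τ - m by ring,
    show w - ((m : ℂ) + n * τ) = w - n * τ - m by ring]
  ring

/-! ### Dependence of the row sums on `τ` -/

/-- The sum over rows at the point `α + β τ`. -/
def rowSum (α β : ℝ) (τ : ℂ) : ℂ := ∑' n : ℤ, cscSq (α + (β - n : ℝ) * τ)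

/-- A summable bound for the terms of `rowSum` on `{τ | δ ≤ Im τ}`. -/
def rowBound (α β δ : ℝ) (n : ℤ) : ℝ :=
  1 / ((β - n) ^ 2 * δ ^ 2) + if β = n then ‖cscSq α‖ else 0

lemma summable_ite_eq_intCast {E : Type*} [AddCommMonoid E] [TopologicalSpace E] (β : ℝ) (c : E) :
    Summable fun n : ℤ => if β = n then c else 0 := by
  refine summable_of_hasFiniteSupport (Set.Finite.subset (Set.finite_singleton ⌊β⌋) ?_)
  intro n hn
  by_contra h
  apply hn
  simp only
  rw [if_neg]
  rintro rfl
  simp at h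

lemma summable_rowBound (α β δ : ℝ) : Summable (rowBound α β δ) := by
  refine Summable.add ?_ (summable_ite_eq_intCast _ _)
  have := ((Real.summable_one_div_int_add_rpow (-β) 2).mpr one_lt_two).mul_right (1 / δ ^ 2)
  refine this.congr fun n => ?_
  rw [Real.rpow_two, sq_abs, one_div_mul_one_div]
  congr 2
  ring

lemma norm_rowSum_term_le (α β : ℝ) {δ : ℝ} (hδ : 0 < δ) (n : ℤ) {τ : ℂ} (hτ : δ ≤ τ.im) :
    ‖cscSq (α + (β - n : ℝ) * τ)‖ ≤ rowBound α β δ n := by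
  unfold rowBound
  split_ifs with h
  · rw [h]; simp
  · have h1 : β - n ≠ 0 := sub_ne_zero.mpr h
    have him : ((α : ℂ) + (β - n : ℝ) * τ).im = (β - n) * τ.im := by
      rw [Complex.add_im, Complex.ofReal_im, Complex.im_ofReal_mul, zero_add]
    have := norm_cscSq_le (z := α + (β - n : ℝ) * τ)
      (by rw [him]; exact mul_ne_zero h1 (by linarith))
    rw [him, mul_pow] at this
    rw [add_zero]
    refine this.trans ?_
    have : 0 < (β - n) ^ 2 := by positivity
    gcongr

lemma summable_rowSum (α β : ℝ) {τ : ℂ} (hτ : 0 < τ.im) :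
    Summable fun n : ℤ => cscSq (α + (β - n : ℝ) * τ) :=
  (summable_rowBound α β τ.im).of_norm_bounded fun n => norm_rowSum_term_le α β hτ n le_rfl

lemma differentiableOn_rowSum (α β : ℝ) : DifferentiableOn ℂ (rowSum α β) {τ | 0 < τ.im} := by
  intro τ hτ
  have hτ : 0 < τ.im := hτ
  have hopen : IsOpen {w : ℂ | τ.im / 2 < w.im} := isOpen_lt continuous_const Complex.continuous_im
  have hd : DifferentiableOn ℂ (rowSum α β) {w | τ.im / 2 < w.im} := by
    refine Complex.differentiableOn_tsum_of_summable_norm (summable_rowBound α β (τ.im / 2))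
      (fun n w hw => ?_) hopen fun n w hw => norm_rowSum_term_le α β (by linarith) n hw.le
    have hw : τ.im / 2 < w.im := hw
    by_cases h : β = n
    · simp only [h, sub_self, Complex.ofReal_zero, zero_mul, add_zero]
      exact differentiableWithinAt_const _
    · have h2 : DifferentiableAt ℂ cscSq (α + (β - n : ℝ) * w) := by
        refine differentiableAt_cscSq (ne_intCast_of_im_ne_zero ?_)
        rw [Complex.add_im, Complex.ofReal_im, Complex.im_ofReal_mul, zero_add]
        exact mul_ne_zero (sub_ne_zero.mpr h) (by linarith)
      exact (h2.comp w (f := fun w : ℂ => (α : ℂ) + (β - n : ℝ) * w)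
        (by fun_prop)).differentiableWithinAt
  exact (hd.differentiableAt (hopen.mem_nhds (by
    change τ.im / 2 < τ.im; linarith))).differentiableWithinAt

/-- Only a row with `n = β` survives: its term is constant in `τ`, while every other term is bounded
by a multiple of `1 / (Im τ)²`. -/
lemma tendsto_rowSum (α β : ℝ) :
    Tendsto (fun τ : ℍ => rowSum α β τ) atImInfty
      (𝓝 (∑' n : ℤ, if β = n then cscSq α else 0)) := by
  have hev (A : ℝ) : ∀ᶠ τ : ℍ in atImInfty, A ≤ τ.im := by
    rw [Filter.Eventually, atImInfty_mem]
    exact ⟨A, fun _ h => h⟩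
  have him : Tendsto UpperHalfPlane.im atImInfty atTop := tendsto_atTop.mpr hev
  refine tendsto_tsum_of_dominated_convergence (summable_rowBound α β 1) (fun n => ?_) ?_
  · split_ifs with h
    · simp only [h, sub_self, Complex.ofReal_zero, zero_mul, add_zero]
      exact tendsto_const_nhds
    · have h1 : β - n ≠ 0 := sub_ne_zero.mpr h
      have h2 : Tendsto (fun τ : ℍ => 1 / ((β - n) ^ 2 * τ.im ^ 2)) atImInfty (𝓝 0) :=
        Tendsto.div_atTop tendsto_const_nhds
          (((tendsto_pow_atTop two_ne_zero).comp him).const_mul_atTop (by positivity))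
      refine squeeze_zero_norm (fun τ => ?_) h2
      have := norm_rowSum_term_le α β τ.im_pos n (τ := τ) le_rfl
      rwa [rowBound, if_neg h, add_zero] at this
  · filter_upwards [hev 1] with τ hτ n using norm_rowSum_term_le α β one_pos n hτ

lemma tendsto_rowSum_zero (α : ℝ) :
    Tendsto (fun τ : ℍ => rowSum α 0 τ) atImInfty (𝓝 (cscSq α)) := by
  have h := tendsto_rowSum α 0
  have h2 : ∑' n : ℤ, (if (0 : ℝ) = n then cscSq α else 0) = cscSq α := by
    rw [tsum_eq_single 0]
    · simp
    · intro n hn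
      rw [if_neg]
      exact_mod_cast hn.symm
  rwa [h2] at h

lemma tendsto_rowSum_half (α : ℝ) :
    Tendsto (fun τ : ℍ => rowSum α (1 / 2) τ) atImInfty (𝓝 0) := by
  have h := tendsto_rowSum α (1 / 2)
  have h2 : ∑' n : ℤ, (if (1 / 2 : ℝ) = n then cscSq α else 0) = 0 := by
    refine (tsum_congr fun n => if_neg fun h => ?_).trans tsum_zero
    have h3 : (1 : ℝ) = 2 * n := by linarith
    have h4 : (1 : ℤ) = 2 * n := by exact_mod_cast h3
    omega
  rwa [h2] at h

lemma wp_sub_eq_rowSum (τ : ℍ) {α β α' β' : ℝ}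
    (hz : (α : ℂ) + β * τ ∉ (periods τ).lattice)
    (hw : (α' : ℂ) + β' * τ ∉ (periods τ).lattice) :
    wp τ (α + β * τ) - wp τ (α' + β' * τ) = rowSum α β τ - rowSum α' β' τ := by
  refine (hasSum_wp_sub τ hz hw).unique ?_
  refine ((summable_rowSum α β τ.im_pos).hasSum.sub
    (summable_rowSum α' β' τ.im_pos).hasSum).congr_fun fun n => ?_
  push_cast
  congr 2 <;> ring

/-! ### Values at points of order two and four -/

section values

variable (τ : ℍ)

lemma mem_lattice_iff (α β : ℚ) :
    (α : ℂ) + β * τ ∈ (periods τ).lattice ↔ α.den = 1 ∧ β.den = 1 := by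
  rw [← (periods τ).mul_ω₁_add_mul_ω₂_mem_lattice]
  simp [periods]

lemma one_mem_lattice : (1 : ℂ) ∈ (periods τ).lattice := (periods τ).ω₁_mem_lattice

lemma quarter_notMem : (1 / 4 : ℂ) ∉ (periods τ).lattice := by
  have := (mem_lattice_iff τ (1 / 4) 0).not.mpr (by norm_num)
  norm_num at this ⊢
  exact this

lemma half_notMem : (1 / 2 : ℂ) ∉ (periods τ).lattice := by
  have := (mem_lattice_iff τ (1 / 2) 0).not.mpr (by norm_num)
  norm_num at this ⊢
  exact this

lemma three_quarters_notMem : (3 / 4 : ℂ) ∉ (periods τ).lattice := by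
  have := (mem_lattice_iff τ (3 / 4) 0).not.mpr (by norm_num)
  norm_num at this ⊢
  exact this

lemma half_tau_notMem : (τ : ℂ) / 2 ∉ (periods τ).lattice := by
  have := (mem_lattice_iff τ 0 (1 / 2)).not.mpr (by norm_num)
  convert this using 2
  push_cast; ring

lemma half_one_add_tau_notMem : (1 + (τ : ℂ)) / 2 ∉ (periods τ).lattice := by
  have := (mem_lattice_iff τ (1 / 2) (1 / 2)).not.mpr (by norm_num)
  convert this using 2
  push_cast; ring

lemma two_mul_half_mem : 2 * (1 / 2 : ℂ) ∈ (periods τ).lattice := by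
  rw [show 2 * (1 / 2 : ℂ) = 1 by norm_num]; exact one_mem_lattice τ

lemma two_mul_half_tau_mem : 2 * ((τ : ℂ) / 2) ∈ (periods τ).lattice := by
  rw [show 2 * ((τ : ℂ) / 2) = τ by ring]; exact (periods τ).ω₂_mem_lattice

lemma two_mul_half_one_add_tau_mem : 2 * ((1 + (τ : ℂ)) / 2) ∈ (periods τ).lattice := by
  rw [show 2 * ((1 + (τ : ℂ)) / 2) = 1 + τ by ring]
  exact add_mem (one_mem_lattice τ) (periods τ).ω₂_mem_lattice

lemma e2_ne_e1 : e2 τ ≠ e1 τ :=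
  weierstrassP_ne_half _ (half_notMem τ) (two_mul_half_mem τ) (half_tau_notMem τ) (by
    rw [show (τ : ℂ) / 2 + 1 / 2 = (1 + τ) / 2 by ring]; exact half_one_add_tau_notMem τ)

lemma e3_ne_e1 : e3 τ ≠ e1 τ :=
  weierstrassP_ne_half _ (half_notMem τ) (two_mul_half_mem τ) (half_one_add_tau_notMem τ) (by
    intro h
    refine half_tau_notMem τ ?_
    convert sub_mem h (one_mem_lattice τ) using 1
    ring)

lemma e3_ne_e2 : e3 τ ≠ e2 τ :=
  weierstrassP_ne_half _ (half_tau_notMem τ) (two_mul_half_tau_mem τ)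
    (half_one_add_tau_notMem τ) (by
    intro h
    refine half_notMem τ ?_
    convert sub_mem h (periods τ).ω₂_mem_lattice using 1
    simp only [periods]
    ring)

/-- The half-period product for `w = 1/2`, evaluated at `z = 1/4`, where `℘(3/4) = ℘(1/4)` makes it
a square, and at `z = τ/2`. -/
lemma wp_quarter_sub_sq :
    (wp τ (1 / 4) - e1 τ) ^ 2 = (e1 τ - e2 τ) * (e1 τ - e3 τ) := by
  obtain ⟨c, -, hc⟩ := exists_halfPeriodProd_eq (periods τ) (half_notMem τ) (two_mul_half_mem τ)
  have h34 : (1 / 4 : ℂ) + 1 / 2 = 3 / 4 := by norm_num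
  have h1 := hc (1 / 4) (quarter_notMem τ) (by rw [h34]; exact three_quarters_notMem τ)
  have hs : (τ : ℂ) / 2 + 1 / 2 = (1 + τ) / 2 := by ring
  have h2 := hc (τ / 2) (half_tau_notMem τ) (by rw [hs]; exact half_one_add_tau_notMem τ)
  have h3 : (periods τ).weierstrassP (3 / 4) = (periods τ).weierstrassP (1 / 4) := by
    have := weierstrassP_add (periods τ) (z := -(1 / 4)) (one_mem_lattice τ)
    rw [(periods τ).weierstrassP_neg] at this
    rw [← this]
    norm_num
  rw [halfPeriodProd, h34, h3] at h1
  rw [halfPeriodProd, hs] at h2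
  simp only [wp, e1, e2, e3]
  linear_combination h1 - h2

lemma wp_quarter_sub_ne_zero : wp τ (1 / 4) - e1 τ ≠ 0 := by
  intro h
  have := wp_quarter_sub_sq τ
  rw [h, zero_pow two_ne_zero] at this
  rcases mul_eq_zero.mp this.symm with h | h
  · exact e2_ne_e1 τ (sub_eq_zero.mp h).symm
  · exact e3_ne_e1 τ (sub_eq_zero.mp h).symm

lemma cubic_half {w : ℂ} (hw : w ∉ (periods τ).lattice) (hw2 : 2 * w ∈ (periods τ).lattice) :
    4 * wp τ w ^ 3 - (periods τ).g₂ * wp τ w - (periods τ).g₃ = 0 := by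
  rw [wp, ← (periods τ).derivWeierstrassP_sq w hw, derivWeierstrassP_half _ hw2,
    zero_pow two_ne_zero]

lemma quarter_add_half_period_notMem {w : ℂ} (h : 2 * w ∈ (periods τ).lattice) :
    1 / 4 + w ∉ (periods τ).lattice := by
  intro h1
  refine half_notMem τ ?_
  convert sub_mem (add_mem h1 h1) h using 1
  ring

/-- Otherwise `℘(1/4)`, `e₁`, `e₂`, `e₃` would be four distinct roots of the cubic `4 x³ - g₂ x -
g₃`. This guarantees that `Z` does not vanish. -/
lemma derivWeierstrassP_quarter_ne_zero : (periods τ).derivWeierstrassP (1 / 4) ≠ 0 := by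
  intro h
  have h0 : 4 * wp τ (1 / 4) ^ 3 - (periods τ).g₂ * wp τ (1 / 4) - (periods τ).g₃ = 0 := by
    rw [wp, ← (periods τ).derivWeierstrassP_sq _ (quarter_notMem τ), h, zero_pow two_ne_zero]
  have h1 := cubic_half τ (half_notMem τ) (two_mul_half_mem τ)
  have h2 := cubic_half τ (half_tau_notMem τ) (two_mul_half_tau_mem τ)
  have h3 := cubic_half τ (half_one_add_tau_notMem τ) (two_mul_half_one_add_tau_mem τ)
  have n {w : ℂ} (hw : w ∉ (periods τ).lattice) (hw2 : 2 * w ∈ (periods τ).lattice) :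
      wp τ (1 / 4) - wp τ w ≠ 0 := sub_ne_zero.mpr <|
    weierstrassP_ne_half _ hw hw2 (quarter_notMem τ) (quarter_add_half_period_notMem τ hw2)
  have n1 := n (half_notMem τ) (two_mul_half_mem τ)
  have n2 := n (half_tau_notMem τ) (two_mul_half_tau_mem τ)
  have n3 := n (half_one_add_tau_notMem τ) (two_mul_half_one_add_tau_mem τ)
  have n12 := sub_ne_zero.mpr (e2_ne_e1 τ)
  have n13 := sub_ne_zero.mpr (e3_ne_e1 τ)
  have n23 := sub_ne_zero.mpr (e3_ne_e2 τ)
  simp only [e1, e2, e3] at n12 n13 n23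
  generalize wp τ (1 / 4) = p at *
  generalize wp τ (1 / 2) = a at *
  generalize wp τ (τ / 2) = b at *
  generalize wp τ ((1 + τ) / 2) = c at *
  have k1 : 4 * (p ^ 2 + p * a + a ^ 2) - (periods τ).g₂ = 0 :=
    mul_left_cancel₀ n1 (by linear_combination h0 - h1)
  have k2 : 4 * (p ^ 2 + p * b + b ^ 2) - (periods τ).g₂ = 0 :=
    mul_left_cancel₀ n2 (by linear_combination h0 - h2)
  have k3 : 4 * (p ^ 2 + p * c + c ^ 2) - (periods τ).g₂ = 0 :=
    mul_left_cancel₀ n3 (by linear_combination h0 - h3)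
  have m1 : p + a + b = 0 := mul_left_cancel₀ n12 (by linear_combination (k2 - k1) / 4)
  have m2 : p + a + c = 0 := mul_left_cancel₀ n13 (by linear_combination (k3 - k1) / 4)
  exact n23 (by linear_combination m2 - m1)

/-- In the addition formula at `z = 1/2`, the factor `ζ(3/4) - 3 ζ(1/4)` equals `η₁ - 4 ζ(1/4) = -4
Z`. -/
lemma hitchinZ_quarter : hitchinZ (1 / 4) 0 τ * (4 * (wp τ (1 / 4) - e1 τ)) =
    -(periods τ).derivWeierstrassP (1 / 4) := by
  obtain ⟨η, hη⟩ := exists_zetaL_add (periods τ) (one_mem_lattice τ)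
  have h1 := hη (-(1 / 2)) (fun h => half_notMem τ (by simpa using neg_mem h))
  have h2 := hη (-(1 / 4)) (fun h => quarter_notMem τ (by simpa using neg_mem h))
  have h34 : (1 / 2 : ℂ) + 1 / 4 = 3 / 4 := by norm_num
  have h14 : (1 / 2 : ℂ) - 1 / 4 = 1 / 4 := by norm_num
  have h := zetaDiff_mul (quarter_notMem τ)
    (by rw [show 2 * (1 / 4 : ℂ) = 1 / 2 by norm_num]; exact half_notMem τ) (half_notMem τ)
    (by rw [h34]; exact three_quarters_notMem τ) (by rw [h14]; exact quarter_notMem τ)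
  rw [show -(1 / 2 : ℂ) + 1 = 1 / 2 by norm_num] at h1
  rw [show -(1 / 4 : ℂ) + 1 = 3 / 4 by norm_num, zetaL_neg] at h2
  rw [zetaDiff, h34, h14] at h
  have he : eta1 τ = η := by rw [eta1, wzeta_eq]; linear_combination h1
  rw [hitchinZ, he, wzeta_eq, zero_mul, zero_mul, add_zero, sub_zero]
  simp only [wp, e1]
  rw [h2] at h
  linear_combination h

/-- Hitchin's solution for `(r, s) = (1/4, 0)`. -/
lemma hitchinLam_quarter :
    hitchinLam (1 / 4) 0 τ = (wp τ (1 / 4) - e1 τ) / (e1 τ - e2 τ) := by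
  have hx := wp_quarter_sub_ne_zero τ
  have hd := derivWeierstrassP_quarter_ne_zero τ
  have hZ := hitchinZ_quarter τ
  have hZ0 : hitchinZ (1 / 4) 0 τ ≠ 0 := by
    intro h
    rw [h, zero_mul] at hZ
    exact hd (neg_eq_zero.mp hZ.symm)
  have h12 := sub_ne_zero.mpr (e2_ne_e1 τ)
  have hq : wpDeriv τ (1 / 4) / (2 * hitchinZ (1 / 4) 0 τ) = -2 * (wp τ (1 / 4) - e1 τ) := by
    rw [div_eq_iff (mul_ne_zero two_ne_zero hZ0)]
    have : wpDeriv τ (1 / 4) = (periods τ).derivWeierstrassP (1 / 4) :=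
      congrFun (periods τ).deriv_weierstrassP (1 / 4)
    rw [this]
    linear_combination hZ
  rw [hitchinLam, zero_mul, add_zero, hq, ← neg_sub (e2 τ) (e1 τ), div_neg, ← neg_div]
  congr 1
  ring

lemma hitchinLam_quarter_sq : hitchinLam (1 / 4) 0 τ ^ 2 = tOf τ := by
  have h12 := sub_ne_zero.mpr (e2_ne_e1 τ)
  have h12' := sub_ne_zero.mpr (e2_ne_e1 τ).symm
  rw [hitchinLam_quarter, div_pow, wp_quarter_sub_sq, tOf]
  field_simp
  ring

lemma tOf_ne_one : tOf τ ≠ 1 := by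
  rw [tOf, ne_eq, div_eq_one_iff_eq (sub_ne_zero.mpr (e2_ne_e1 τ))]
  intro h
  exact e3_ne_e2 τ (sub_left_injective h)

lemma hitchinLam_quarter_ne_zero : hitchinLam (1 / 4) 0 τ ≠ 0 := by
  rw [hitchinLam_quarter]
  exact div_ne_zero (wp_quarter_sub_ne_zero τ) (sub_ne_zero.mpr (e2_ne_e1 τ).symm)

/-! ### Holomorphy of `λ⁽⁰⁾` in `τ` and its limit at `i∞` -/

lemma wp_quarter_sub_eq_rowSum :
    wp τ (1 / 4) - e1 τ = rowSum (1 / 4) 0 τ - rowSum (1 / 2) 0 τ := by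
  have := wp_sub_eq_rowSum τ (α := 1 / 4) (β := 0) (α' := 1 / 2) (β' := 0)
    (by simpa using quarter_notMem τ) (by simpa using half_notMem τ)
  simpa [e1] using this

lemma e1_sub_e2_eq_rowSum :
    e1 τ - e2 τ = rowSum (1 / 2) 0 τ - rowSum 0 (1 / 2) τ := by
  have h : ((0 : ℝ) : ℂ) + ((1 / 2 : ℝ) : ℂ) * τ = τ / 2 := by push_cast; ring
  have := wp_sub_eq_rowSum τ (α := 1 / 2) (β := 0) (α' := 0) (β' := 1 / 2)
    (by simpa using half_notMem τ) (by rw [h]; exact half_tau_notMem τ)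
  rw [h] at this
  simpa [e1, e2] using this

end values

lemma mdifferentiable_hitchinLam_quarter :
    MDifferentiable 𝓘(ℂ) 𝓘(ℂ) (hitchinLam (1 / 4) 0) := by
  rw [UpperHalfPlane.mdifferentiable_iff]
  have h : DifferentiableOn ℂ (fun τ : ℂ => (rowSum (1 / 4) 0 τ - rowSum (1 / 2) 0 τ) /
      (rowSum (1 / 2) 0 τ - rowSum 0 (1 / 2) τ)) {τ | 0 < τ.im} := by
    refine ((differentiableOn_rowSum _ _).sub (differentiableOn_rowSum _ _)).div
      ((differentiableOn_rowSum _ _).sub (differentiableOn_rowSum _ _)) fun τ hτ => ?_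
    have := e1_sub_e2_eq_rowSum ⟨τ, hτ⟩
    rw [coe_mk] at this
    simp only [← this]
    exact sub_ne_zero.mpr (e2_ne_e1 _).symm
  refine h.congr fun τ hτ => ?_
  rw [Function.comp_apply, ofComplex_apply_of_im_pos hτ, hitchinLam_quarter,
    wp_quarter_sub_eq_rowSum, e1_sub_e2_eq_rowSum]

/-- The limit is `(2π² - π²) / (π² - 0)`; it decides which square root of `t` occurs. -/
lemma tendsto_hitchinLam_quarter : Tendsto (hitchinLam (1 / 4) 0) atImInfty (𝓝 1) := by
  have hpi : (Real.pi : ℂ) ≠ 0 := by exact_mod_cast Real.pi_ne_zero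
  have h2 : cscSq ((1 / 2 : ℝ) : ℂ) = Real.pi ^ 2 := by
    rw [cscSq, ← Complex.ofReal_mul, ← Complex.ofReal_sin, mul_one_div, Real.sin_pi_div_two]
    simp
  have h4 : cscSq ((1 / 4 : ℝ) : ℂ) = 2 * Real.pi ^ 2 := by
    rw [cscSq, ← Complex.ofReal_mul, ← Complex.ofReal_sin, mul_one_div, Real.sin_pi_div_four,
      ← Complex.ofReal_pow, ← Complex.ofReal_pow, div_pow, Real.sq_sqrt (by norm_num)]
    push_cast
    ring
  have h := ((tendsto_rowSum_zero (1 / 4)).sub (tendsto_rowSum_zero (1 / 2))).div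
    ((tendsto_rowSum_zero (1 / 2)).sub (tendsto_rowSum_half 0))
    (by rw [h2, sub_zero]; exact pow_ne_zero 2 hpi)
  rw [h2, h4, sub_zero, show (2 * (Real.pi : ℂ) ^ 2 - Real.pi ^ 2) / Real.pi ^ 2 = 1 by
    field_simp; norm_num] at h
  refine h.congr fun τ => ?_
  rw [hitchinLam_quarter, wp_quarter_sub_eq_rowSum, e1_sub_e2_eq_rowSum]
  rfl

/-! ### The Hamiltonian system -/

lemma deriv_hamiltonian_mu (θ : Param) (l m t : ℂ) :
    deriv (fun m => hamiltonian θ l m t) m = 1 / (t * (t - 1)) *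
      (2 * (l * (l - 1) * (l - t)) * m -
        (θ.th1 * (l - 1) * (l - t) + θ.th2 * l * (l - t) + (θ.th3 - 1) * l * (l - 1))) := by
  refine HasDerivAt.deriv ?_
  unfold hamiltonian
  have h1 := ((hasDerivAt_id m).pow 2).const_mul (l * (l - 1) * (l - t))
  have h2 := (hasDerivAt_id m).const_mul
    (θ.th1 * (l - 1) * (l - t) + θ.th2 * l * (l - t) + (θ.th3 - 1) * l * (l - 1))
  refine (((h1.add_const (θ.th0 * (θ.th0 + θ.th4) * (l - t))).sub h2).const_mul
    (1 / (t * (t - 1)))).congr_deriv ?_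
  simp only [id, Nat.cast_ofNat]
  ring

lemma deriv_hamiltonian_lam (θ : Param) (l m t : ℂ) :
    deriv (fun l => hamiltonian θ l m t) l = 1 / (t * (t - 1)) *
      ((3 * l ^ 2 - 2 * (1 + t) * l + t) * m ^ 2 + θ.th0 * (θ.th0 + θ.th4) -
        (θ.th1 * (2 * l - 1 - t) + θ.th2 * (2 * l - t) + (θ.th3 - 1) * (2 * l - 1)) * m) := by
  refine HasDerivAt.deriv ?_
  have e : (fun l => hamiltonian θ l m t) = fun l => 1 / (t * (t - 1)) *
      ((m ^ 2 * l ^ 3 + (-(1 + t) * m ^ 2 - (θ.th1 + θ.th2 + θ.th3 - 1) * m) * l ^ 2 +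
        (t * m ^ 2 + θ.th0 * (θ.th0 + θ.th4) +
          (θ.th1 * (1 + t) + θ.th2 * t + (θ.th3 - 1)) * m) * l) +
        (-θ.th0 * (θ.th0 + θ.th4) * t - θ.th1 * t * m)) := by
    ext l
    unfold hamiltonian
    ring
  rw [e]
  refine ((((((hasDerivAt_id l).pow 3).const_mul _).add
    (((hasDerivAt_id l).pow 2).const_mul _)).add ((hasDerivAt_id l).const_mul _)).add_const _
      |>.const_mul _).congr_deriv ?_
  simp only [id, Nat.cast_ofNat]
  ring

/-- For `λ² = t`, the first Hamiltonian equation at `θ⁰` holds if `μ = 1 / (4 λ)`. -/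
lemma deriv_hamiltonian_mu_thetaZero {l : ℂ} (hl : l ≠ 0) (h1 : l ^ 2 ≠ 1) (m : ℂ) :
    deriv (fun m => hamiltonian thetaZero l m (l ^ 2)) m * (2 * l) =
      1 - 4 * l / (l + 1) * (m - 1 / (4 * l)) * (l - 1) := by
  have h2 : l - 1 ≠ 0 := fun h => h1 (by rw [sub_eq_zero.mp h]; norm_num)
  have h3 : l + 1 ≠ 0 := fun h => h1 (by rw [eq_neg_of_add_eq_zero_left h]; norm_num)
  rw [deriv_hamiltonian_mu]
  have e : l ^ 2 * (l ^ 2 - 1) = l ^ 2 * ((l - 1) * (l + 1)) := by ring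
  rw [e]
  simp only [thetaZero]
  field_simp
  ring

/-- With `dt = 2 λ dλ`, this is the second Hamiltonian equation for `μ = 1 / (4 λ)`, since `-dμ/dλ =
1 / (4 λ²)`. -/
lemma deriv_hamiltonian_lam_thetaZero {l : ℂ} (hl : l ≠ 0) (h1 : l ^ 2 ≠ 1) :
    deriv (fun l' => hamiltonian thetaZero l' (1 / (4 * l)) (l ^ 2)) l * (2 * l) =
      1 / (4 * l ^ 2) := by
  have h2 : l - 1 ≠ 0 := fun h => h1 (by rw [sub_eq_zero.mp h]; norm_num)
  have h3 : l + 1 ≠ 0 := fun h => h1 (by rw [eq_neg_of_add_eq_zero_left h]; norm_num)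
  rw [deriv_hamiltonian_lam]
  have e : l ^ 2 * (l ^ 2 - 1) = l ^ 2 * ((l - 1) * (l + 1)) := by ring
  rw [e]
  simp only [thetaZero]
  field_simp
  ring

lemma differentiableAt_comp_ofComplex {f : ℍ → ℂ} (hf : MDifferentiable 𝓘(ℂ) 𝓘(ℂ) f) (τ : ℍ) :
    DifferentiableAt ℂ (f ∘ ofComplex) (τ : ℂ) :=
  (UpperHalfPlane.mdifferentiable_iff.mp hf).differentiableAt
    (isOpen_upperHalfPlaneSet.mem_nhds τ.im_pos)

lemma hasDerivAt_comp_ofComplex {f : ℍ → ℂ} (hf : MDifferentiable 𝓘(ℂ) 𝓘(ℂ) f) (τ : ℍ) :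
    HasDerivAt (f ∘ ofComplex) (tauDeriv f τ) (τ : ℂ) :=
  (differentiableAt_comp_ofComplex hf τ).hasDerivAt

section solutions

variable {lam : ℍ → ℂ}

lemma tauDeriv_tOf (hlam : MDifferentiable 𝓘(ℂ) 𝓘(ℂ) lam) (hsq : ∀ τ, lam τ ^ 2 = tOf τ)
    (τ : ℍ) : tauDeriv tOf τ = 2 * lam τ * tauDeriv lam τ := by
  have h : tOf ∘ ofComplex = fun z => (lam ∘ ofComplex) z ^ 2 := by
    ext z; simp [hsq]
  rw [tauDeriv, h, ((hasDerivAt_comp_ofComplex hlam τ).fun_pow 2).deriv]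
  simp

/-- A square root `λ` of `t` satisfies the Hamiltonian system at `θ⁰` with `μ = 1 / (4 λ)`. -/
lemma isHamiltonianSolution_sqrt (hlam : MDifferentiable 𝓘(ℂ) 𝓘(ℂ) lam)
    (hsq : ∀ τ, lam τ ^ 2 = tOf τ) (h0 : ∀ τ, lam τ ≠ 0) :
    IsHamiltonianSolution thetaZero lam (fun τ => 1 / (4 * lam τ)) := by
  have h1 (τ : ℍ) : lam τ ^ 2 ≠ 1 := hsq τ ▸ tOf_ne_one τ
  have hd (τ : ℍ) : HasDerivAt ((fun τ => 1 / (4 * lam τ)) ∘ ofComplex)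
      (-tauDeriv lam τ / (4 * lam τ ^ 2)) τ := by
    have h := (hasDerivAt_comp_ofComplex hlam τ).const_mul 4
    have hne : 4 * (lam ∘ ofComplex) (τ : ℂ) ≠ 0 := by simp [h0]
    refine ((h.fun_inv hne).congr_of_eventuallyEq
      (Eventually.of_forall fun z => by simp)).congr_deriv ?_
    have := h0 τ
    simp only [Function.comp_apply, ofComplex_apply]
    field_simp
  refine ⟨hlam, ?_, fun τ => ?_, fun τ => ?_⟩
  · rw [UpperHalfPlane.mdifferentiable_iff]
    exact fun z hz => (hd ⟨z, hz⟩).differentiableAt.differentiableWithinAt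
  · have h := deriv_hamiltonian_mu_thetaZero (h0 τ) (h1 τ) (1 / (4 * lam τ))
    rw [tauDeriv_tOf hlam hsq, ← hsq]
    linear_combination -tauDeriv lam τ * h
  · have h := deriv_hamiltonian_lam_thetaZero (h0 τ) (h1 τ)
    have h2 : tauDeriv (fun τ => 1 / (4 * lam τ)) τ = _ := (hd τ).deriv
    rw [h2, tauDeriv_tOf hlam hsq, ← hsq, ← mul_assoc, neg_mul, h]
    ring

/-- The function `μ` is determined by a square root `λ` of `t`. -/
lemma isHamiltonianSolution_sqrt_unique (hlam : MDifferentiable 𝓘(ℂ) 𝓘(ℂ) lam)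
    (hsq : ∀ τ, lam τ ^ 2 = tOf τ) (h0 : ∀ τ, lam τ ≠ 0) (hlim : Tendsto lam atImInfty (𝓝 1))
    {nu : ℍ → ℂ} (hnu : IsHamiltonianSolution thetaZero lam nu) :
    nu = fun τ => 1 / (4 * lam τ) := by
  have h1 (τ : ℍ) : lam τ ^ 2 ≠ 1 := hsq τ ▸ tOf_ne_one τ
  have hmu := isHamiltonianSolution_sqrt hlam hsq h0
  have hprod (τ : ℍ) : (nu τ - 1 / (4 * lam τ)) * tauDeriv lam τ = 0 := by
    have h2 : lam τ - 1 ≠ 0 := fun h => h1 τ (by rw [sub_eq_zero.mp h]; norm_num)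
    have h3 : lam τ + 1 ≠ 0 := fun h => h1 τ (by rw [eq_neg_of_add_eq_zero_left h]; norm_num)
    have h := deriv_hamiltonian_mu_thetaZero (h0 τ) (h1 τ) (nu τ)
    have h4 := hnu.eq_lam τ
    rw [tauDeriv_tOf hlam hsq, ← hsq] at h4
    have h5 : 4 * lam τ / (lam τ + 1) * (lam τ - 1) ≠ 0 :=
      mul_ne_zero (div_ne_zero (mul_ne_zero (by norm_num) (h0 τ)) h3) h2
    refine mul_left_cancel₀ h5 ?_
    linear_combination h4 + tauDeriv lam τ * h
  have hU : IsPreconnected {z : ℂ | 0 < z.im} := (convex_halfSpace_im_gt 0).isPreconnected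
  have hA : AnalyticOnNhd ℂ (fun z => (nu ∘ ofComplex) z -
      ((fun τ => 1 / (4 * lam τ)) ∘ ofComplex) z) {z : ℂ | 0 < z.im} :=
    ((UpperHalfPlane.mdifferentiable_iff.mp hnu.holo_mu).sub
      (UpperHalfPlane.mdifferentiable_iff.mp hmu.holo_mu)).analyticOnNhd isOpen_upperHalfPlaneSet
  have hL := UpperHalfPlane.mdifferentiable_iff.mp hlam
  have hB : AnalyticOnNhd ℂ (deriv (lam ∘ ofComplex)) {z : ℂ | 0 < z.im} :=
    (hL.analyticOnNhd isOpen_upperHalfPlaneSet).deriv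
  -- `λ'` could have isolated zeros, so the product is not divided pointwise: one of the two
  -- analytic factors must vanish identically. If it is `λ'`, then `λ` is constantly 1 by its limit,
  -- contradicting `t ≠ 1`.
  rcases hA.eq_zero_or_eq_zero_of_smul_eq_zero hB (fun z hz => by
      have := hprod ⟨z, hz⟩
      simpa [ofComplex_apply_of_im_pos hz, tauDeriv] using this) hU with h | h
  · ext τ
    have := h τ τ.im_pos
    simpa [sub_eq_zero] using this
  · exfalso
    obtain ⟨c, hc⟩ := isOpen_upperHalfPlaneSet.exists_is_const_of_deriv_eq_zero hU hL h
    have hc' (τ : ℍ) : lam τ = c := by simpa using hc τ τ.im_pos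
    have hc1 : c = 1 := tendsto_nhds_unique (tendsto_const_nhds.congr fun τ => (hc' τ).symm) hlim
    exact h1 UpperHalfPlane.I (by rw [hc', hc1, one_pow])

end solutions

/-! ### The action of the Okamoto transformations -/

/-- For `λ = u`, `t = u²` and equal `θ₁, θ₂, θ₃`, the three shifts of `μ` telescope: `1/u + 1/(u -
1) + 1/(u - u²) = 2/u`. -/
lemma kappa321_apply {u : ℂ} (hu : u ≠ 0) (hu1 : u ≠ 1) (a b c m : ℂ) :
    kappa3 (kappa2 (kappa1 ⟨⟨a, b, b, b, c⟩, u, m, u ^ 2⟩)) =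
      ⟨⟨a + 3 * b, -b, -b, -b, c⟩, u, m - 2 * b / u, u ^ 2⟩ := by
  have h1 : u - 1 ≠ 0 := sub_ne_zero.mpr hu1
  have h2 : u - u ^ 2 ≠ 0 := by
    rw [show u - u ^ 2 = -(u * (u - 1)) by ring]
    exact neg_ne_zero.mpr (mul_ne_zero hu h1)
  simp only [kappa1, kappa2, kappa3, State.mk.injEq, Param.mk.injEq, true_and, and_true]
  refine ⟨by ring, ?_⟩
  have h3 : b / (u - u ^ 2) = -(b / (u * (u - 1))) := by
    rw [← div_neg]; congr 1; ring
  rw [h3]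
  field_simp
  ring

/-- The image of the solution `(t^{1/2}, t^{-1/2} / 4)` under `κ^{0,N}`, where `s = ± t^{1/2}`. -/
def sqrtState (N s : ℂ) : State :=
  ⟨⟨-((N + 1) / 2), 1 / 2, 1 / 2, 1 / 2, 1 / 2 + N⟩, s / (2 * N + 1), (2 * N + 1) / (4 * s), s ^ 2⟩

lemma kappa01_sqrtState {s : ℂ} (hs : s ≠ 0) (hs1 : s ≠ 1) :
    kappa01 (sqrtState 0 s) = sqrtState 1 (-s) := by
  have e : sqrtState 0 s = ⟨⟨-(1 / 2), 1 / 2, 1 / 2, 1 / 2, 1 / 2⟩, s, 1 / (4 * s), s ^ 2⟩ := by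
    simp [sqrtState]
  rw [e, kappa01, Function.comp, Function.comp, Function.comp, kappa321_apply hs hs1]
  have hm : 1 / (4 * s) - 2 * (1 / 2) / s = -3 / (4 * s) := by field_simp; norm_num
  rw [hm]
  simp only [kappa0, sqrtState, State.mk.injEq, Param.mk.injEq]
  refine ⟨⟨?_, ?_, ?_, ?_, ?_⟩, ?_, ?_, ?_⟩ <;> field_simp <;> norm_num

/-- The three occurrences of `κ₀` in `κ₅` take `λ` to `s`, then `-s`, then `s / (2N + 5)`. Before
each block `κ₃ κ₂ κ₁` one thus has `λ² = t`, so `kappa321_apply` applies, once at `s` and once at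
`-s`. -/
lemma kappa5_sqrtState {N s : ℂ} (hs : s ≠ 0) (hs1 : s ≠ 1) (hs2 : s ≠ -1)
    (h1 : 2 * N + 1 ≠ 0) (h3 : 2 * N + 3 ≠ 0) (h5 : 2 * N + 5 ≠ 0) :
    kappa5 (sqrtState N s) = sqrtState (N + 2) s := by
  have e1 : kappa0 (kappa4 (sqrtState N s)) =
      ⟨⟨-(N / 2), (1 + N) / 2, (1 + N) / 2, (1 + N) / 2, -(1 + N) / 2⟩, s,
        (2 * N + 1) / (4 * s), s ^ 2⟩ := by
    simp only [kappa0, kappa4, sqrtState, State.mk.injEq, Param.mk.injEq]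
    refine ⟨⟨by ring, by ring, by ring, by ring, by ring⟩, ?_, trivial, trivial⟩
    generalize hD : 2 * N + 1 = D at *
    obtain rfl : N = (D - 1) / 2 := by linear_combination hD / 2
    field_simp
    ring
  have e2 : kappa0 ⟨⟨-(N / 2) + 3 * ((1 + N) / 2), -((1 + N) / 2), -((1 + N) / 2),
      -((1 + N) / 2), -(1 + N) / 2⟩, s, (2 * N + 1) / (4 * s) - 2 * ((1 + N) / 2) / s, s ^ 2⟩ =
      ⟨⟨-(N + 3 / 2), N / 2 + 1, N / 2 + 1, N / 2 + 1, N / 2 + 1⟩, -s,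
        -(2 * N + 3) / (4 * s), (-s) ^ 2⟩ := by
    have hm : (2 * N + 1) / (4 * s) - 2 * ((1 + N) / 2) / s = -(2 * N + 3) / (4 * s) := by
      field_simp; ring
    rw [hm]
    have h3' : -(2 * N + 3) ≠ 0 := neg_ne_zero.mpr h3
    simp only [kappa0, State.mk.injEq, Param.mk.injEq]
    refine ⟨⟨by ring, by ring, by ring, by ring, by ring⟩, ?_, trivial, by ring⟩
    generalize hD : -(2 * N + 3) = D at *
    obtain rfl : N = (-D - 3) / 2 := by linear_combination -hD / 2
    field_simp
    ring
  have e3 : kappa0 ⟨⟨-(N + 3 / 2) + 3 * (N / 2 + 1), -(N / 2 + 1), -(N / 2 + 1), -(N / 2 + 1),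
      N / 2 + 1⟩, -s, -(2 * N + 3) / (4 * s) - 2 * (N / 2 + 1) / (-s), (-s) ^ 2⟩ =
      sqrtState (N + 2) s := by
    have hm : -(2 * N + 3) / (4 * s) - 2 * (N / 2 + 1) / (-s) = (2 * N + 5) / (4 * s) := by
      rw [div_neg]; field_simp; ring
    rw [hm]
    simp only [kappa0, sqrtState, State.mk.injEq, Param.mk.injEq]
    refine ⟨⟨by ring, by ring, by ring, by ring, by ring⟩, ?_, by ring, by ring⟩
    rw [show 2 * (N + 2) + 1 = 2 * N + 5 by ring]
    generalize hD : 2 * N + 5 = D at *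
    obtain rfl : N = (D - 5) / 2 := by linear_combination hD / 2
    field_simp
    ring
  change kappa0 (kappa3 (kappa2 (kappa1 (kappa0 (kappa3 (kappa2 (kappa1
    (kappa0 (kappa4 (sqrtState N s)))))))))) = _
  rw [e1, kappa321_apply hs hs1, e2, kappa321_apply (neg_ne_zero.mpr hs)
    (fun h => hs2 (by rw [← h, neg_neg])), e3]

lemma natCast_two_mul_add_odd_ne_zero (N k : ℕ) : (2 * (N : ℂ) + (2 * k + 1 : ℕ)) ≠ 0 := by
  have : (2 * N + (2 * k + 1) : ℕ) ≠ 0 := by omega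
  exact_mod_cast this

lemma kappa5_iterate_sqrtState {s : ℂ} (hs : s ≠ 0) (hs1 : s ≠ 1) (hs2 : s ≠ -1) (N m : ℕ) :
    kappa5^[m] (sqrtState N s) = sqrtState ((N + 2 * m : ℕ) : ℂ) s := by
  induction m with
  | zero => simp
  | succ m ih =>
    have h1 := natCast_two_mul_add_odd_ne_zero (N + 2 * m) 0
    have h3 := natCast_two_mul_add_odd_ne_zero (N + 2 * m) 1
    have h5 := natCast_two_mul_add_odd_ne_zero (N + 2 * m) 2
    norm_num only [Nat.cast_ofNat, Nat.cast_one] at h1 h3 h5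
    rw [Function.iterate_succ_apply', ih, kappa5_sqrtState hs hs1 hs2 h1 h3 h5]
    congr 1
    push_cast
    ring

lemma kappa0n_sqrtState {s : ℂ} (hs : s ≠ 0) (hs1 : s ≠ 1) (hs2 : s ≠ -1) (n : ℕ) :
    kappa0n n (sqrtState 0 s) = sqrtState n ((-1) ^ n * s) := by
  unfold kappa0n
  split_ifs with h
  · have := kappa5_iterate_sqrtState hs hs1 hs2 0 (n / 2)
    rw [Nat.cast_zero, zero_add, Nat.two_mul_div_two_of_even h] at this
    rw [this, h.neg_one_pow, one_mul]
  · have h := Nat.not_even_iff_odd.mp h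
    have := kappa5_iterate_sqrtState (neg_ne_zero.mpr hs) (fun h => hs2 (by rw [← h, neg_neg]))
      (fun h => hs1 (neg_injective h)) 1 (n / 2)
    rw [Nat.cast_one, show 1 + 2 * (n / 2) = n by
      have := Nat.two_mul_div_two_add_one_of_odd h; omega] at this
    rw [Function.comp_apply, kappa01_sqrtState hs hs1, this, h.neg_one_pow, neg_one_mul]

/-! ### Branch points -/

lemma not_isBranchPoint_one {s : ℍ → ℂ} (hs : Continuous s) (hsq : ∀ τ, s τ ^ 2 = tOf τ)
    {f : ℍ → ℂ} {c : ℂ} (hf : ∀ τ, f τ = c * s τ) : ¬ IsBranchPoint f 1 := by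
  intro h
  -- On `Re t > 0` a square root of `t` cannot be purely imaginary. By the intermediate value
  -- theorem its real part keeps its sign along the path, which excludes `s τ₁ = -s τ₂`.
  obtain ⟨τ₁, τ₂, ⟨γ, hγ⟩, ht, hne⟩ := h {z | 0 < z.re}
    ((isOpen_lt continuous_const Complex.continuous_re).mem_nhds (by simp))
  apply hne
  rw [hf, hf]
  have hsign : s τ₁ = s τ₂ ∨ s τ₁ = -s τ₂ := sq_eq_sq_iff_eq_or_eq_neg.mp (by rw [hsq, hsq, ht])
  rcases hsign with h | h
  · rw [h]
  exfalso
  have hre (x : unitInterval) : (s (γ x)).re ≠ 0 := by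
    intro h0
    have h1 : 0 < (tOf (γ x)).re := (hγ x).1
    rw [← hsq, sq, Complex.mul_re, h0] at h1
    nlinarith [mul_self_nonneg (s (γ x)).im]
  have hc : Continuous fun x => (s (γ x)).re :=
    Complex.continuous_re.comp (hs.comp γ.continuous)
  have hre0 := hre 0
  have hre1 := hre 1
  have h01 : (s (γ 0)).re = -(s (γ 1)).re := by simp [h]
  rcases lt_or_gt_of_ne hre0 with h2 | h2
  · obtain ⟨x, hx⟩ := mem_range_of_exists_le_of_exists_ge hc ⟨0, h2.le⟩ ⟨1, by linarith⟩
    exact hre x hx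
  · obtain ⟨x, hx⟩ := mem_range_of_exists_le_of_exists_ge hc ⟨1, by linarith⟩ ⟨0, h2.le⟩
    exact hre x hx

end PVI

end

theorem mainTheorem11 :
    -- the branch of `t^{1/2}` that tends to `1` as `τ → i∞`
    ∃ sqrtT : ℍ → ℂ,
      MDifferentiable 𝓘(ℂ) 𝓘(ℂ) sqrtT ∧
      (∀ τ, sqrtT τ ^ 2 = PVI.tOf τ) ∧
      (∀ τ, sqrtT τ ≠ 0) ∧
      Tendsto sqrtT atImInfty (𝓝 1) ∧
    -- the function `μ⁽⁰⁾` that corresponds to `λ⁽⁰⁾`, which exists and is unique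
    ∃ mu0 : ℍ → ℂ,
      PVI.IsHamiltonianSolution PVI.thetaZero (PVI.hitchinLam (1 / 4) 0) mu0 ∧
      (∀ nu : ℍ → ℂ,
        PVI.IsHamiltonianSolution PVI.thetaZero (PVI.hitchinLam (1 / 4) 0) nu → nu = mu0) ∧
      ∀ n : ℕ,
        (∀ τ : ℍ,
          PVI.lamN n (PVI.hitchinLam (1 / 4) 0) mu0 τ =
            (-1) ^ n / (2 * (n : ℂ) + 1) * sqrtT τ ∧
          PVI.muN n (PVI.hitchinLam (1 / 4) 0) mu0 τ =
            1 / (4 * PVI.lamN n (PVI.hitchinLam (1 / 4) 0) mu0 τ) ∧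
          PVI.muN n (PVI.hitchinLam (1 / 4) 0) mu0 τ =
            (-1) ^ n * ((2 * (n : ℂ) + 1) / 4) * (sqrtT τ)⁻¹) ∧
        ¬ PVI.IsBranchPoint (PVI.lamN n (PVI.hitchinLam (1 / 4) 0) mu0) 1 := by
  have hlam := PVI.mdifferentiable_hitchinLam_quarter
  have hsq := PVI.hitchinLam_quarter_sq
  have h0 := PVI.hitchinLam_quarter_ne_zero
  have hlim := PVI.tendsto_hitchinLam_quarter
  refine ⟨PVI.hitchinLam (1 / 4) 0, hlam, hsq, h0, hlim,
    fun τ => 1 / (4 * PVI.hitchinLam (1 / 4) 0 τ), PVI.isHamiltonianSolution_sqrt hlam hsq h0,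
    fun nu hnu => PVI.isHamiltonianSolution_sqrt_unique hlam hsq h0 hlim hnu, fun n => ?_⟩
  -- From here on only the properties of a holomorphic, nowhere vanishing square root of `t` matter.
  generalize PVI.hitchinLam (1 / 4) 0 = s at *
  have hstate (τ : ℍ) : PVI.kappa0n n ⟨PVI.thetaZero, s τ, 1 / (4 * s τ), PVI.tOf τ⟩ =
      PVI.sqrtState n ((-1) ^ n * s τ) := by
    have h1 : s τ ^ 2 ≠ 1 := hsq τ ▸ PVI.tOf_ne_one τ
    rw [← PVI.kappa0n_sqrtState (h0 τ) (fun h => h1 (by rw [h, one_pow]))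
      (fun h => h1 (by rw [h]; norm_num)), ← hsq]
    simp [PVI.sqrtState, PVI.thetaZero]
  have hl (τ : ℍ) : PVI.lamN n s (fun τ => 1 / (4 * s τ)) τ =
      (-1) ^ n / (2 * (n : ℂ) + 1) * s τ := by
    rw [PVI.lamN, hstate, PVI.sqrtState]
    ring
  have hm (τ : ℍ) : PVI.muN n s (fun τ => 1 / (4 * s τ)) τ =
      (-1) ^ n * ((2 * (n : ℂ) + 1) / 4) * (s τ)⁻¹ := by
    have h3 : ((-1 : ℂ) ^ n)⁻¹ = (-1) ^ n := by
      rw [← inv_pow]; norm_num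
    rw [PVI.muN, hstate, PVI.sqrtState]
    simp only [div_eq_mul_inv, mul_inv, h3]
    ring
  refine ⟨fun τ => ⟨hl τ, ?_, hm τ⟩, PVI.not_isBranchPoint_one hlam.continuous hsq hl⟩
  rw [hm, hl]
  have h3 : ((-1 : ℂ) ^ n)⁻¹ = (-1) ^ n := by
    rw [← inv_pow]; norm_num
  simp only [div_eq_mul_inv, mul_inv, h3, inv_inv]
  ring
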